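/- For an integer $M\ge 1$ let $h=\pi/M$ and let $\mathbb{T}_h=\{hj : j=-M,\dots,M-1\}$ be the periodic lattice, with dual $\mathbb{T}_h^*=\{-M,\dots,M-1\}$. For $f:\mathbb{T}_h\to\mathbb{C}$ let $\|f\|_{L^r_h}$ ($1\le r\le\infty$) be the Lebesgue norm for the measure giving mass $h$ to each point, let $\mathcal{F}_h[f](k)=h\sum_{x\in\mathbb{T}_h}f(x)e^{-ikx}$ for $k\in\mathbb{T}_h^*$, with inverse $\mathcal{F}_h^{-1}[g](x)=\frac1{2\pi}\sum_{k\in\mathbb{T}_h^*}g(k)e^{ikx}$, and for $s\in\mathbb{R}$ put $$\|f\|_{H^s_h}^2=\frac1{2\pi}\sum_{k\in\mathbb{T}_h^*}(1+|k|^2)^{s}\,|\mathcal{F}_h[f](k)|^2 .$$ For $\alpha\in(1,2]$ and $t\in\mathbb{R}$ let $U_h(t)=e^{-it(-\Delta_h)^{\alpha/2}}$ be the Fourier multiplier operator $$U_h(t)f=\mathcal{F}_h^{-1}\Big[e^{-it\left|\frac2h\sin\frac{hk}{2}\right|^{\alpha}}\,\mathcal{F}_h[f](k)\Big].$$ Call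 $(q,r)\in[2,\infty]^2$ lattice-admissible if $\frac3q+\frac1r=\frac12$ (with $\frac1\infty=0$). Corollary. For every $\epsilon>0$ there is a constant $C_\epsilon>0$, depending only on $\epsilon$, such that for all $\alpha\in(1,2]$, all lattice-admissible $(q,r)$, and all $h=\pi/M$ with $M\ge1$ an integer: $$\|U_h(t)f\|_{L^q([0,1];L^r_h)}\le C_\epsilon\,|\alpha-1|^{-\frac16\left(1-\frac2r\right)}\,\|f\|_{H_h^{\frac2q+\epsilon}}\qquad\text{for all } f:\mathbb{T}_h\to\mathbb{C},$$ $$\left\|\int_0^t U_h(t-t')F(t')\,dt'\right\|_{L^q([0,1];L^r_h)}\le C_\epsilon\,|\alpha-1|^{-\frac13\left(1-\frac2r\right)}\,\|F\|_{L^1([0,1];H_h^{\frac2q+\epsilon})}\qquad\text{for all } F\in L^1([0,1];H_h^{\frac2q+\epsilon}).$$ -/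

import Mathlib

open MeasureTheory
open scoped ENNReal

namespace FDNLS

noncomputable section

/-- The index set `{-M, …, M - 1}`. An index `j` stands for the point `h j` of the periodic
lattice `𝕋_h`, and an index `k` for a frequency in the dual `𝕋_h^*`. -/
abbrev Idx (M : ℕ) : Type := {j : ℤ // j ∈ Finset.Ico (-(M : ℤ)) (M : ℤ)}

/-- The mesh size `h = π / M`. -/
def mesh (M : ℕ) : ℝ := Real.pi / M

/-- The point `x = h j` of the lattice `𝕋_h`. -/
def pt {M : ℕ} (j : Idx M) : ℝ := mesh M * (j.1 : ℝ)

/-- The normalized counting measure on the lattice: each point has mass `h`. -/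
def latticeMeasure (M : ℕ) : Measure (Idx M) :=
  ENNReal.ofReal (mesh M) • Measure.count

/-- The `L^r_h` norm, `r ∈ [1, ∞]`. -/
def latticeNorm {M : ℕ} (r : ℝ≥0∞) (f : Idx M → ℂ) : ℝ≥0∞ :=
  eLpNorm f r (latticeMeasure M)

/-- The discrete Fourier transform `h ∑_x f(x) e^{-ikx}`. -/
def dft {M : ℕ} (f : Idx M → ℂ) (k : Idx M) : ℂ :=
  (mesh M : ℂ) * ∑ j : Idx M, f j * Complex.exp (-Complex.I * (k.1 : ℂ) * (pt j : ℂ))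

/-- The inverse discrete Fourier transform `(2π)⁻¹ ∑_k g(k) e^{ikx}`. -/
def idft {M : ℕ} (g : Idx M → ℂ) (j : Idx M) : ℂ :=
  (2 * (Real.pi : ℂ))⁻¹ *
    ∑ k : Idx M, g k * Complex.exp (Complex.I * (k.1 : ℂ) * (pt j : ℂ))

/-- The symbol `|(2/h) sin(hξ/2)|^α` of the discrete fractional Laplacian `(-Δ_h)^{α/2}`. -/
def symbol (M : ℕ) (α ξ : ℝ) : ℝ :=
  |2 / mesh M * Real.sin (mesh M * ξ / 2)| ^ α

/-- The linear propagator `U_h(t) = e^{-it(-Δ_h)^{α/2}}`, the Fourier multiplier with symbol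
`e^{-itσ_h(k)}`. -/
def propagator {M : ℕ} (α t : ℝ) (f : Idx M → ℂ) : Idx M → ℂ :=
  idft fun k => Complex.exp (-Complex.I * (t : ℂ) * (symbol M α (k.1 : ℝ) : ℂ)) * dft f k

/-- `⟨ξ⟩ = (1 + |ξ|²)^{1/2}`. -/
def bracket (ξ : ℝ) : ℝ := Real.sqrt (1 + |ξ| ^ 2)

/-- The discrete Sobolev norm of `H^s_h`. -/
def sobolevNorm {M : ℕ} (s : ℝ) (f : Idx M → ℂ) : ℝ :=
  Real.sqrt ((2 * Real.pi)⁻¹ * ∑ k : Idx M, bracket (k.1 : ℝ) ^ (2 * s) * ‖dft f k‖ ^ 2)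

/-- Lattice-admissible pairs `(q, r) ∈ [2, ∞]²` in dimension one: `3/q + 1/r = 1/2`. -/
def LatticeAdmissible (q r : ℝ≥0∞) : Prop :=
  2 ≤ q ∧ 2 ≤ r ∧ 3 / q + 1 / r = 1 / 2

/-- Lebesgue measure on the time interval `[0, 1]`. -/
def timeMeasure : Measure ℝ := volume.restrict (Set.Icc 0 1)

/-- The space-time norm of `L^q([0,1]; L^r_h)`. -/
def spacetimeNorm {M : ℕ} (q r : ℝ≥0∞) (u : ℝ → Idx M → ℂ) : ℝ≥0∞ :=
  eLpNorm (fun t => latticeNorm r (u t)) q timeMeasure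

/-- The Duhamel term `∫₀ᵗ U_h(t - t') F(t') dt'`. -/
def duhamel {M : ℕ} (α : ℝ) (F : ℝ → Idx M → ℂ) (t : ℝ) : Idx M → ℂ :=
  ∫ t' in (0 : ℝ)..t, propagator α (t - t') (F t')

/-- The norm of `L^1([0,1]; H^s_h)`. -/
def sourceNorm {M : ℕ} (s : ℝ) (F : ℝ → Idx M → ℂ) : ℝ≥0∞ :=
  eLpNorm (fun t => sobolevNorm s (F t)) 1 timeMeasure

end

end FDNLS

open MeasureTheory
open scoped ENNReal

namespace FDNLS

/-! Frequencies are split into the origin and the blocks `N ≤ ±k < 2N` with `N = 2^n`. On one block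
the kernel is the exponential sum of `x k - t σ(k)`, where `σ = chord ^ α`. Its second derivative is
`α chord^(α-2) (α - 1 - α sin²(hξ/2))`. Since `sin²` increases on the block, there is at most one
inflection. For `4 |t| N^(α-1) ≤ 1` the phase increments, with `x` reduced modulo `2π`, stay in a
window of half-width `π + 1`, so van der Corput's second derivative test applies directly to the
sum. The test is used on the convex and on the concave side, and the short range around the
inflection is estimated trivially. Balancing the two costs gives `dispersive_estimate`: the kernel
is `O(((α-1) N^(α-3) |t|)^(-1/3))`, uniformly in `h`.

A kernel of size `A |t-s|^(-1/3)` yields, by duality (`TT*`), the weak bound `λ^6 |{sup_x |u| ≥ λ}|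
≲ A^3 ‖c‖^6` on each short interval (`large_values_short`). Covering `[0,1]` costs a factor
`N^(α-1)`, and `N^(α-1) A^3 ≈ N² / (α-1)`, so the `L^6_t L^∞_x` norm on a block costs `N^(1/3)
(α-1)^(-1/6)`. Passing from weak to strong type by counting dyadic levels loses only a power of `n +
1` (`lintegral_block`), which the `ε` derivatives pay for.

With `θ = 1 - 2/r = 6/q`, interpolation at each time against the conserved `L²` norm gives every
admissible pair, with cost `N^(θ/3) = N^(2/q)`. The block bounds are summed by the triangle
inequality (`eLpNorm_majorant_le`).

For the Duhamel term, `U_h(t-s) F(s)` is a free evolution in `t` with coefficients depending on `s`,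
so Minkowski's inequality reduces it to the homogeneous bound. This even gives the power `-θ/6`,
which is stronger than the required `-θ/3` because `α - 1 ≤ 1`. -/

/-! ### Exponential sums -/

/-- An upward closed predicate on an integer interval holds on a final segment. -/
lemma exists_threshold (P : ℕ → Prop) {p r : ℕ} (hpr : p ≤ r)
    (hP : ∀ k, p ≤ k → k + 1 < r → P k → P (k + 1)) :
    ∃ m, p ≤ m ∧ m ≤ r ∧ (∀ k ∈ Finset.Ico p m, ¬ P k) ∧ ∀ k ∈ Finset.Ico m r, P k := by
  classical
  induction r, hpr using Nat.le_induction with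
  | base => exact ⟨p, le_rfl, le_rfl, by simp, by simp⟩
  | succ r hr ih =>
    obtain ⟨m, h1, h2, h3, h4⟩ := ih fun k hk hk' => hP k hk (by omega)
    rcases h2.lt_or_eq with h | rfl
    · refine ⟨m, h1, by omega, h3, fun k hk => ?_⟩
      rw [Finset.mem_Ico] at hk
      rcases (Nat.lt_succ_iff_lt_or_eq.1 hk.2) with h' | rfl
      · exact h4 k (Finset.mem_Ico.2 ⟨hk.1, h'⟩)
      · have := hP (k - 1) (by omega) (by omega) (h4 (k - 1) (Finset.mem_Ico.2 ⟨by omega, by omega⟩))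
        rwa [show k - 1 + 1 = k by omega] at this
    · by_cases hm : P m
      · refine ⟨m, h1, by omega, h3, fun k hk => ?_⟩
        rw [Finset.mem_Ico] at hk
        rwa [show k = m by omega]
      · refine ⟨m + 1, by omega, le_rfl, fun k hk => ?_, by simp⟩
        rw [Finset.mem_Ico] at hk
        rcases (Nat.lt_succ_iff_lt_or_eq.1 hk.2) with h' | rfl
        · exact h3 k (Finset.mem_Ico.2 ⟨hk.1, h'⟩)
        · exact hm

/-- Jordan's inequality, reflected about `π/2` for the larger angles. It keeps `e^{iθ}` away from
`1`. -/
lemma sin_half_lower {δ θ : ℝ} (hδ : 0 ≤ δ) (h1 : δ ≤ θ) (h2 : θ ≤ 2 * Real.pi - δ) :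
    δ / Real.pi ≤ Real.sin (θ / 2) := by
  have hpi := Real.pi_pos
  have key : ∀ y, δ / 2 ≤ y → y ≤ Real.pi / 2 → δ / Real.pi ≤ Real.sin y := fun y hy hy' => by
    refine le_trans ?_ (Real.mul_le_sin (by linarith) hy')
    calc δ / Real.pi = 2 / Real.pi * (δ / 2) := by field_simp
      _ ≤ 2 / Real.pi * y := by gcongr
  rcases le_total (θ / 2) (Real.pi / 2) with h | h
  · exact key _ (by linarith) h
  · rw [← Real.sin_pi_sub]
    exact key _ (by linarith) (by linarith)

/-- The half-angle cotangent. -/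
noncomputable def halfCot (θ : ℝ) : ℝ := Real.cos (θ / 2) / Real.sin (θ / 2)

/-- After cross-multiplication this is the nonnegativity of `sin (y/2 - x/2)`. -/
lemma halfCot_anti {x y : ℝ} (hx : 0 < x) (hxy : x ≤ y) (hy : y < 2 * Real.pi) :
    halfCot y ≤ halfCot x := by
  have sx : 0 < Real.sin (x / 2) := Real.sin_pos_of_pos_of_lt_pi (by linarith) (by linarith)
  have sy : 0 < Real.sin (y / 2) := Real.sin_pos_of_pos_of_lt_pi (by linarith) (by linarith)
  unfold halfCot
  rw [div_le_div_iff₀ sy sx]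
  have : 0 ≤ Real.sin (y / 2 - x / 2) :=
    Real.sin_nonneg_of_nonneg_of_le_pi (by linarith) (by linarith)
  rw [Real.sin_sub] at this
  linarith

lemma abs_halfCot_le {δ θ : ℝ} (hδ : 0 < δ) (h1 : δ ≤ θ) (h2 : θ ≤ 2 * Real.pi - δ) :
    |halfCot θ| ≤ Real.pi / δ := by
  have h := sin_half_lower hδ.le h1 h2
  have hp : 0 < δ / Real.pi := div_pos hδ Real.pi_pos
  unfold halfCot
  rw [abs_div, abs_of_pos (hp.trans_le h), show Real.pi / δ = 1 / (δ / Real.pi) by field_simp]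
  exact div_le_div₀ zero_le_one (Real.abs_cos_le_one _) hp h

/-- The inverse of `e^{iθ} - 1` has constant real part, so its variation is that of a monotone real
function; this drives the summation by parts in `kuzmin_landau`. -/
lemma halfCot_multiplier_mul {θ : ℝ} (hθ : Real.sin (θ / 2) ≠ 0) :
    (-(1 / 2 : ℂ) - Complex.I / 2 * (halfCot θ : ℂ)) * (Complex.exp (Complex.I * θ) - 1) = 1 := by
  have e : Complex.exp (Complex.I * θ) =
      (Complex.cos (θ / 2) + Complex.sin (θ / 2) * Complex.I) ^ 2 := by
    rw [← Complex.exp_mul_I, ← Complex.exp_nat_mul]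
    congr 1
    push_cast
    ring
  have h0 : Complex.sin ((θ : ℂ) / 2) ≠ 0 := by exact_mod_cast hθ
  have h1 := Complex.sin_sq_add_cos_sq ((θ : ℂ) / 2)
  have h2 := Complex.I_sq
  rw [e]
  unfold halfCot
  push_cast
  field_simp
  generalize Complex.sin ((θ : ℂ) / 2) = s at *
  generalize Complex.cos ((θ : ℂ) / 2) = c at *
  linear_combination (-s ^ 3 -2 * s * c ^ 2 - s * c * Complex.I ^ 1 * s) * h2 + (s - c * Complex.I) * h1

lemma norm_multiplier_le {δ θ : ℝ} (hδ : 0 < δ) (h1 : δ ≤ θ) (h2 : θ ≤ 2 * Real.pi - δ) :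
    ‖(-(1 / 2 : ℂ) - Complex.I / 2 * (halfCot θ : ℂ))‖ ≤ Real.pi / δ := by
  have h := abs_halfCot_le hδ h1 h2
  have h3 : 1 ≤ Real.pi / δ := by rw [le_div_iff₀ hδ]; linarith
  calc _ ≤ ‖(-(1 / 2 : ℂ))‖ + ‖Complex.I / 2 * (halfCot θ : ℂ)‖ := norm_sub_le _ _
    _ = 1 / 2 + 1 / 2 * |halfCot θ| := by simp
    _ ≤ _ := by linarith

/-- The Kuzmin–Landau inequality. -/
lemma kuzmin_landau (φ : ℕ → ℝ) {p r : ℕ} {δ : ℝ} (hδ : 0 < δ)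
    (hlo : ∀ k ∈ Finset.Ico p r, δ ≤ φ (k + 1) - φ k)
    (hhi : ∀ k ∈ Finset.Ico p r, φ (k + 1) - φ k ≤ 2 * Real.pi - δ)
    (hmono : ∀ k, p ≤ k → k + 1 < r → φ (k + 1) - φ k ≤ φ (k + 2) - φ (k + 1)) :
    ‖∑ k ∈ Finset.Ico p r, Complex.exp (Complex.I * φ k)‖ ≤ 10 / δ := by
  rcases le_or_gt r p with h | h
  · simp only [Finset.Ico_eq_empty_of_le h, Finset.sum_empty, norm_zero]; positivity
  set θ : ℕ → ℝ := fun k => φ (k + 1) - φ k with hθ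
  set c : ℕ → ℂ := fun k => -(1 / 2 : ℂ) - Complex.I / 2 * (halfCot (θ k) : ℂ) with hc
  set z : ℕ → ℂ := fun k => Complex.exp (Complex.I * φ k) with hz
  have hz1 : ∀ k, ‖z k‖ = 1 := fun k => by
    rw [hz]; simp only; rw [mul_comm]; exact Complex.norm_exp_ofReal_mul_I _
  have hcz : ∀ k ∈ Finset.Ico p r, z k = c k * (z (k + 1) - z k) := fun k hk => by
    have hs : Real.sin (θ k / 2) ≠ 0 :=
      ((div_pos hδ Real.pi_pos).trans_le (sin_half_lower hδ.le (hlo k hk) (hhi k hk))).ne'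
    have e : z (k + 1) = z k * Complex.exp (Complex.I * θ k) := by
      simp only [hz, hθ]
      rw [← Complex.exp_add]
      congr 1
      push_cast
      ring
    rw [e]
    linear_combination (-z k) * halfCot_multiplier_mul hs
  -- Summation by parts as an induction: each step adds `|c m - c (m+1)|`, and these telescope
  -- because the cotangent decreases along the monotone increments.
  have main : ∀ m, p ≤ m → m < r →
      ‖∑ k ∈ Finset.Ico p (m + 1), z k - c m * z (m + 1)‖ ≤
        ‖c p‖ + (halfCot (θ p) - halfCot (θ m)) / 2 := by
    intro m hm
    induction m, hm using Nat.le_induction with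
    | base =>
      intro _
      have : ∑ k ∈ Finset.Ico p (p + 1), z k - c p * z (p + 1) = -(c p * z p) := by
        rw [Nat.Ico_succ_singleton, Finset.sum_singleton]
        linear_combination hcz p (Finset.mem_Ico.2 ⟨le_rfl, h⟩)
      rw [this, norm_neg, norm_mul, hz1]
      simp
    | succ m hm ih =>
      intro hmr
      have hm1 : m ∈ Finset.Ico p r := Finset.mem_Ico.2 ⟨hm, by omega⟩
      have hm2 : m + 1 ∈ Finset.Ico p r := Finset.mem_Ico.2 ⟨by omega, hmr⟩
      have e : ∑ k ∈ Finset.Ico p (m + 1 + 1), z k - c (m + 1) * z (m + 1 + 1) =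
          (∑ k ∈ Finset.Ico p (m + 1), z k - c m * z (m + 1)) + (c m - c (m + 1)) * z (m + 1) := by
        rw [Finset.sum_Ico_succ_top (by omega)]
        linear_combination hcz (m + 1) hm2
      have hanti : halfCot (θ (m + 1)) ≤ halfCot (θ m) :=
        halfCot_anti (hδ.trans_le (hlo m hm1)) (hmono m hm hmr)
          (by have := hhi _ hm2; simp only [hθ]; linarith)
      have e2 : ‖c m - c (m + 1)‖ = (halfCot (θ m) - halfCot (θ (m + 1))) / 2 := by
        have : c m - c (m + 1) =
            -(Complex.I / 2 * ((halfCot (θ m) - halfCot (θ (m + 1)) : ℝ) : ℂ)) := by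
          simp only [hc]; push_cast; ring
        rw [this, norm_neg, norm_mul, Complex.norm_real, Real.norm_eq_abs,
          abs_of_nonneg (by linarith)]
        simp
        ring
      rw [e]
      refine (norm_add_le _ _).trans ?_
      rw [norm_mul, hz1, mul_one, e2]
      have := ih (by omega)
      linarith
  have h1 := main (r - 1) (by omega) (by omega)
  rw [show r - 1 + 1 = r by omega] at h1
  have hp : p ∈ Finset.Ico p r := Finset.mem_Ico.2 ⟨le_rfl, h⟩
  have hr : r - 1 ∈ Finset.Ico p r := Finset.mem_Ico.2 ⟨by omega, by omega⟩
  have b1 : ‖c p‖ ≤ _ := norm_multiplier_le hδ (hlo p hp) (hhi p hp)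
  have b2 : ‖c (r - 1)‖ ≤ _ := norm_multiplier_le hδ (hlo _ hr) (hhi _ hr)
  have b3 := abs_le.1 (abs_halfCot_le hδ (hlo p hp) (hhi p hp))
  have b4 := abs_le.1 (abs_halfCot_le hδ (hlo _ hr) (hhi _ hr))
  have b5 : ‖∑ k ∈ Finset.Ico p r, z k‖ ≤
      ‖∑ k ∈ Finset.Ico p r, z k - c (r - 1) * z r‖ + ‖c (r - 1) * z r‖ := by
    simpa using norm_add_le (∑ k ∈ Finset.Ico p r, z k - c (r - 1) * z r) (c (r - 1) * z r)
  rw [norm_mul, hz1, mul_one] at b5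
  -- One `π/δ` for each of the two boundary multipliers and one for the total variation.
  have b6 : 3 * (Real.pi / δ) ≤ 10 / δ := by
    rw [← mul_div_assoc]
    gcongr
    linarith [Real.pi_lt_d2]
  simp only [hθ] at h1 b3 b4
  linarith [b3.2, b4.1]

lemma norm_sum_exp_le_card (φ : ℕ → ℝ) (s : Finset ℕ) :
    ‖∑ k ∈ s, Complex.exp (Complex.I * φ k)‖ ≤ s.card := by
  refine (norm_sum_le _ _).trans ?_
  rw [Finset.card_eq_sum_ones, Nat.cast_sum]
  refine Finset.sum_le_sum fun k _ => ?_
  rw [mul_comm, Complex.norm_exp_ofReal_mul_I]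
  simp

/-- The second derivative test of van der Corput, for a convex phase whose increments stay in a
window around zero of length less than `4 π`. -/
lemma second_difference_test (φ : ℕ → ℝ) {p r : ℕ} {lam : ℝ} (hlam : 0 < lam)
    (hwin : ∀ k ∈ Finset.Ico p r, |φ (k + 1) - φ k| ≤ Real.pi + 1)
    (hinc : ∀ k, p ≤ k → k + 1 < r → lam ≤ (φ (k + 2) - φ (k + 1)) - (φ (k + 1) - φ k)) :
    ‖∑ k ∈ Finset.Ico p r, Complex.exp (Complex.I * φ k)‖ ≤ 23 * (1 + lam ^ (-(1 / 2) : ℝ)) := by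
  have hpi := Real.pi_gt_three
  rcases le_or_gt r p with h | h
  · simp only [Finset.Ico_eq_empty_of_le h, Finset.sum_empty, norm_zero]; positivity
  -- `√lam` balances `1/δ` from Kuzmin–Landau against the `δ/lam` terms with increment in `(-δ, δ)`;
  -- the cap `1` makes `δ ≤ π - 1`, so the outer ranges stay `δ` away from `2πℤ`.
  set δ : ℝ := min 1 (lam ^ (1 / 2 : ℝ)) with hδd
  have hl2 : 0 < lam ^ (1 / 2 : ℝ) := Real.rpow_pos_of_pos hlam _
  have hδ : 0 < δ := lt_min one_pos hl2
  have hδ1 : δ ≤ 1 := min_le_left _ _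
  obtain ⟨m₁, a1, a2, a3, a4⟩ := exists_threshold (fun k => -δ < φ (k + 1) - φ k) h.le
    fun k hk hk' hP => by have := hinc k hk hk'; linarith
  obtain ⟨m₂, c1, c2, c3, c4⟩ := exists_threshold (fun k => δ ≤ φ (k + 1) - φ k) a2
    fun k hk hk' hP => by
      have := hinc k (a1.trans hk) hk'
      linarith
  simp only [not_lt, not_le] at a3 c3
  have s1 : ‖∑ k ∈ Finset.Ico p m₁, Complex.exp (Complex.I * φ k)‖ ≤ 10 / δ := by
    -- Adding `2πk` to the phase leaves the exponentials unchanged and moves the negative increments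
    -- into `[δ, 2π - δ]`.
    have e : ∀ k : ℕ, Complex.exp (Complex.I * φ k) =
        Complex.exp (Complex.I * ((φ k + 2 * Real.pi * k : ℝ) : ℂ)) := fun k => by
      rw [show Complex.I * ((φ k + 2 * Real.pi * k : ℝ) : ℂ) =
        Complex.I * φ k + k * (2 * Real.pi * Complex.I) by push_cast; ring, Complex.exp_add,
        Complex.exp_nat_mul_two_pi_mul_I, mul_one]
    simp only [e]
    refine kuzmin_landau (fun k => φ k + 2 * Real.pi * k) hδ (fun k hk => ?_) (fun k hk => ?_)
      fun k hk hk' => ?_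
    · have := abs_le.1 (hwin k (Finset.Ico_subset_Ico_right a2 hk))
      push_cast
      linarith [this.1]
    · have := a3 k hk
      push_cast
      linarith
    · have := hinc k hk (by omega)
      push_cast
      linarith
  have s3 : ‖∑ k ∈ Finset.Ico m₂ r, Complex.exp (Complex.I * φ k)‖ ≤ 10 / δ := by
    refine kuzmin_landau φ hδ c4 (fun k hk => ?_) fun k hk hk' => ?_
    · have := abs_le.1 (hwin k (Finset.Ico_subset_Ico_left (a1.trans c1) hk))
      linarith [this.2]
    · have := hinc k ((a1.trans c1).trans hk) (by omega)
      linarith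
  have s2 : ‖∑ k ∈ Finset.Ico m₁ m₂, Complex.exp (Complex.I * φ k)‖ ≤ 2 * δ / lam + 1 := by
    refine (norm_sum_exp_le_card _ _).trans ?_
    rw [Nat.card_Ico]
    rcases c1.eq_or_lt with e | hlt
    · rw [e]; simp; positivity
    -- Increments grow by at least `lam` per step, so they cross `(-δ, δ)` in at most `2δ/lam + 1`
    -- steps.
    have step : ∀ m, m₁ ≤ m → m < m₂ →
        ((m - m₁ : ℕ) : ℝ) * lam ≤ (φ (m + 1) - φ m) - (φ (m₁ + 1) - φ m₁) := by
      intro m hm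
      induction m, hm using Nat.le_induction with
      | base => simp
      | succ m hm ih =>
        intro h'
        have := hinc m (a1.trans hm) (by omega)
        have := ih (by omega)
        rw [show m + 1 - m₁ = m - m₁ + 1 by omega]
        push_cast
        linarith
    have st := step (m₂ - 1) (by omega) (by omega)
    have u1 := c3 (m₂ - 1) (Finset.mem_Ico.2 ⟨by omega, by omega⟩)
    have u2 := a4 m₁ (Finset.mem_Ico.2 ⟨le_rfl, by omega⟩)
    rw [show m₂ - m₁ = (m₂ - 1 - m₁) + 1 by omega]
    push_cast
    have : ((m₂ - 1 - m₁ : ℕ) : ℝ) ≤ 2 * δ / lam := by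
      rw [le_div_iff₀ hlam]
      linarith
    linarith
  have e : ∑ k ∈ Finset.Ico p r, Complex.exp (Complex.I * φ k) =
      ∑ k ∈ Finset.Ico p m₁, Complex.exp (Complex.I * φ k) +
        ∑ k ∈ Finset.Ico m₁ m₂, Complex.exp (Complex.I * φ k) +
        ∑ k ∈ Finset.Ico m₂ r, Complex.exp (Complex.I * φ k) := by
    rw [Finset.sum_Ico_consecutive _ a1 c1, Finset.sum_Ico_consecutive _ (a1.trans c1) c2]
  have hinv : lam ^ (-(1 / 2) : ℝ) = 1 / lam ^ (1 / 2 : ℝ) := by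
    rw [Real.rpow_neg hlam.le]; exact (one_div _).symm
  have d1 : 1 / δ ≤ 1 + lam ^ (-(1 / 2) : ℝ) := by
    rw [hinv]
    rcases min_choice 1 (lam ^ (1 / 2 : ℝ)) with h' | h' <;> rw [hδd, h']
    · rw [div_one]; linarith [one_div_pos.2 hl2]
    · linarith
  have d2 : δ / lam ≤ lam ^ (-(1 / 2) : ℝ) := by
    rw [hinv, div_le_div_iff₀ hlam hl2]
    calc δ * lam ^ (1 / 2 : ℝ) ≤ lam ^ (1 / 2 : ℝ) * lam ^ (1 / 2 : ℝ) := by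
          gcongr; exact min_le_right _ _
      _ = 1 * lam := by rw [← Real.rpow_add hlam]; norm_num
  rw [e]
  have := norm_add₃_le (a := ∑ k ∈ Finset.Ico p m₁, Complex.exp (Complex.I * φ k))
    (b := ∑ k ∈ Finset.Ico m₁ m₂, Complex.exp (Complex.I * φ k))
    (c := ∑ k ∈ Finset.Ico m₂ r, Complex.exp (Complex.I * φ k))
  have e3 : 10 / δ = 10 * (1 / δ) := by ring
  have e4 : 2 * δ / lam = 2 * (δ / lam) := by ring
  rw [e3] at s1 s3
  rw [e4] at s2
  have : 0 ≤ lam ^ (-(1 / 2) : ℝ) := by positivity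
  linarith

/-! ### The dispersion relation -/

/-- The mean value theorem, applied first to `x ↦ f (x + 1) - f x` and then to `f'`. -/
lemma le_second_difference {f f' f'' : ℝ → ℝ} {a lam : ℝ}
    (h1 : ∀ x ∈ Set.Icc a (a + 2), HasDerivAt f (f' x) x)
    (h2 : ∀ x ∈ Set.Icc a (a + 2), HasDerivAt f' (f'' x) x)
    (h3 : ∀ x ∈ Set.Icc a (a + 2), lam ≤ f'' x) :
    lam ≤ (f (a + 2) - f (a + 1)) - (f (a + 1) - f a) := by
  have hG : ∀ x ∈ Set.Icc a (a + 1), HasDerivAt (fun x => f (x + 1) - f x) (f' (x + 1) - f' x) x :=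
    fun x hx => ((h1 (x + 1) ⟨by linarith [hx.1], by linarith [hx.2]⟩).comp_add_const x 1).sub
      (h1 x ⟨hx.1, by linarith [hx.2]⟩)
  obtain ⟨c, hc, hc'⟩ := exists_hasDerivAt_eq_slope (fun x => f (x + 1) - f x)
    (fun x => f' (x + 1) - f' x) (by linarith : a < a + 1)
    (fun x hx => (hG x hx).continuousAt.continuousWithinAt)
    fun x hx => hG x ⟨hx.1.le, hx.2.le⟩
  have hI : ∀ x ∈ Set.Icc c (c + 1), x ∈ Set.Icc a (a + 2) := fun x hx =>
    ⟨by linarith [hx.1, hc.1], by linarith [hx.2, hc.2]⟩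
  obtain ⟨d, hd, hd'⟩ := exists_hasDerivAt_eq_slope f' f'' (by linarith : c < c + 1)
    (fun x hx => (h2 x (hI x hx)).continuousAt.continuousWithinAt)
    fun x hx => h2 x (hI x ⟨hx.1.le, hx.2.le⟩)
  have := h3 d (hI d ⟨hd.1.le, hd.2.le⟩)
  rw [show a + 1 + 1 = a + 2 by ring] at hc'
  simp only [add_sub_cancel_left, div_one] at hc' hd'
  linarith

/-- The chord length `2/h sin(hξ/2)`. -/
noncomputable def chord (h ξ : ℝ) : ℝ := 2 / h * Real.sin (h * ξ / 2)

section

variable {h ξ α : ℝ}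

lemma chord_pos (hh : 0 < h) (hξ : 0 < ξ) (hξ' : h * ξ ≤ Real.pi) : 0 < chord h ξ := by
  refine mul_pos (by positivity) (Real.sin_pos_of_pos_of_lt_pi (by positivity) ?_)
  linarith [Real.pi_pos]

lemma chord_le (hh : 0 < h) (hξ : 0 ≤ ξ) : chord h ξ ≤ ξ := by
  calc chord h ξ ≤ 2 / h * (h * ξ / 2) := by
        unfold chord; gcongr; exact Real.sin_le (by positivity)
    _ = ξ := by field_simp

lemma hasDerivAt_chord (hh : 0 < h) : HasDerivAt (chord h) (Real.cos (h * ξ / 2)) ξ := by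
  have h1 : HasDerivAt (fun ξ : ℝ => h * ξ / 2) (h / 2) ξ := by
    simpa using ((hasDerivAt_id ξ).const_mul h).div_const 2
  refine (h1.sin.const_mul (2 / h)).congr_deriv ?_
  field_simp

lemma hasDerivAt_chord_rpow (hh : 0 < h) (hξ : 0 < ξ) (hξ' : h * ξ ≤ Real.pi) :
    HasDerivAt (fun ξ => chord h ξ ^ α) (α * chord h ξ ^ (α - 1) * Real.cos (h * ξ / 2)) ξ := by
  refine ((hasDerivAt_chord (ξ := ξ) hh).rpow_const (p := α)
    (Or.inl (chord_pos hh hξ hξ').ne')).congr_deriv ?_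
  ring

/-- The last factor is `(α - 1) cos² - sin²` rewritten in `sin²` alone. It shows the single
inflection, at `sin² = (α - 1)/α`. -/
lemma hasDerivAt_deriv_chord_rpow (hh : 0 < h) (hξ : 0 < ξ) (hξ' : h * ξ ≤ Real.pi) :
    HasDerivAt (fun ξ => α * chord h ξ ^ (α - 1) * Real.cos (h * ξ / 2))
      (α * chord h ξ ^ (α - 2) * (α - 1 - α * Real.sin (h * ξ / 2) ^ 2)) ξ := by
  have hc := chord_pos hh hξ hξ'
  have h1 : HasDerivAt (fun ξ : ℝ => h * ξ / 2) (h / 2) ξ := by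
    simpa using ((hasDerivAt_id ξ).const_mul h).div_const 2
  refine (((hasDerivAt_chord_rpow (α := α - 1) hh hξ hξ').const_mul α).mul h1.cos).congr_deriv ?_
  have e1 : chord h ξ ^ (α - 1) = chord h ξ ^ (α - 2) * chord h ξ := by
    rw [← Real.rpow_add_one hc.ne']; congr 1; ring
  have e2 : chord h ξ * (h / 2) = Real.sin (h * ξ / 2) := by
    unfold chord; field_simp
  have e3 := Real.sin_sq_add_cos_sq (h * ξ / 2)
  rw [e1, show α - 1 - 1 = α - 2 by ring]
  linear_combination (-α * chord h ξ ^ (α - 2) * Real.sin (h * ξ / 2)) * e2 +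
    (α * chord h ξ ^ (α - 2) * (α - 1)) * e3

/-- On a dyadic block the increments of the dispersion relation are `O(N^{α - 1})`. -/
lemma abs_increment_le (hh : 0 < h) (hα : 1 < α) (hα2 : α ≤ 2) {N : ℝ} (hN : 1 ≤ N)
    (hξ : N ≤ ξ) (hξ2 : ξ + 1 ≤ 2 * N) (hξ' : h * (ξ + 1) ≤ Real.pi) :
    |chord h (ξ + 1) ^ α - chord h ξ ^ α| ≤ 4 * N ^ (α - 1) := by
  have hI : ∀ x ∈ Set.Icc ξ (ξ + 1), 0 < x ∧ h * x ≤ Real.pi := fun x hx =>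
    ⟨by linarith [hx.1], (mul_le_mul_of_nonneg_left hx.2 hh.le).trans hξ'⟩
  have hd : ∀ x ∈ Set.Icc ξ (ξ + 1), HasDerivAt (fun ξ => chord h ξ ^ α) _ x := fun x hx =>
    hasDerivAt_chord_rpow hh (hI x hx).1 (hI x hx).2
  obtain ⟨c, hc, hc'⟩ := exists_hasDerivAt_eq_slope (fun ξ => chord h ξ ^ α)
    (fun ξ => α * chord h ξ ^ (α - 1) * Real.cos (h * ξ / 2)) (by linarith : ξ < ξ + 1)
    (fun x hx => (hd x hx).continuousAt.continuousWithinAt)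
    fun x hx => hd x ⟨hx.1.le, hx.2.le⟩
  simp only [add_sub_cancel_left, div_one] at hc'
  rw [← hc']
  have hc0 : 0 < c := (hI c ⟨hc.1.le, hc.2.le⟩).1
  have hp := chord_pos hh hc0 (hI c ⟨hc.1.le, hc.2.le⟩).2
  rw [abs_mul, abs_of_nonneg (by positivity)]
  calc α * chord h c ^ (α - 1) * |Real.cos (h * c / 2)| ≤ 2 * (2 * N) ^ (α - 1) * 1 := by
        gcongr
        · exact (chord_le hh hc0.le).trans (by linarith [hc.2])
        · exact Real.abs_cos_le_one _
    _ = 2 * 2 ^ (α - 1) * N ^ (α - 1) := by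
        rw [Real.mul_rpow (by norm_num) (by linarith)]; ring
    _ ≤ 2 * 2 ^ (1 : ℝ) * N ^ (α - 1) := by
        gcongr
        · norm_num
        · linarith
    _ = _ := by norm_num

/-- The exponent `α - 2` is nonpositive, so the upper bound `chord ≤ ξ ≤ 2N` suffices, uniformly in
`h`. -/
lemma half_rpow_le_chord_rpow (hh : 0 < h) (hα : 1 < α) (hα2 : α ≤ 2) {N : ℝ} (hN : 1 ≤ N)
    (hξ : 0 < ξ) (hξ2 : ξ ≤ 2 * N) (hξ' : h * ξ ≤ Real.pi) :
    N ^ (α - 2) / 2 ≤ α * chord h ξ ^ (α - 2) := by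
  have hp := chord_pos hh hξ hξ'
  calc N ^ (α - 2) / 2 = 1 * ((2:ℝ) ^ (-1 : ℝ) * N ^ (α - 2)) := by
        rw [Real.rpow_neg_one]; ring
    _ ≤ α * ((2:ℝ) ^ (α - 2) * N ^ (α - 2)) := by
        gcongr
        · norm_num
        · linarith
    _ = α * (2 * N) ^ (α - 2) := by rw [Real.mul_rpow (by norm_num) (by linarith)]
    _ ≤ _ := by
        gcongr ?_ * ?_
        exact Real.rpow_le_rpow_of_nonpos hp ((chord_le hh hξ.le).trans hξ2) (by linarith)

end

lemma sin_sq_mono {h x y : ℝ} (hh : 0 < h) (hx : 0 ≤ x) (hxy : x ≤ y) (hy : h * y ≤ Real.pi) :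
    Real.sin (h * x / 2) ^ 2 ≤ Real.sin (h * y / 2) ^ 2 := by
  have h0 : 0 ≤ h * x := by positivity
  have h1 : h * x ≤ h * y := by gcongr
  have := Real.pi_pos
  refine pow_le_pow_left₀ (Real.sin_nonneg_of_nonneg_of_le_pi (by linarith) (by linarith)) ?_ 2
  exact Real.sin_le_sin_of_le_of_le_pi_div_two (by linarith) (by linarith) (by linarith)

/-- The set where the dispersion relation is nearly degenerate is short. -/
lemma near_degenerate_length {h α η N j k : ℝ} (hh : 0 < h) (hα : 1 < α) (hα2 : α ≤ 2)
    (hη : 0 < η) (hN : 1 ≤ N) (hj : N ≤ j) (hjk : j ≤ k) (hk : k ≤ 2 * N) (hk' : h * k ≤ Real.pi)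
    (h1 : α - 1 - η < α * Real.sin (h * j / 2) ^ 2)
    (h2 : α * Real.sin (h * k / 2) ^ 2 < α - 1 + η) :
    k - j ≤ 40 * (η * N / (α - 1)) := by
  have ha : 0 < α - 1 := by linarith
  have hpi := Real.pi_pos
  rw [mul_div_assoc', le_div_iff₀ ha]
  rcases le_or_gt ((α - 1) / 4) η with hbig | hsmall
  -- For large `η` the trivial length `N` of the block is enough.
  · have : (k - j) * (α - 1) ≤ N * (4 * η) := by
      gcongr <;> linarith
    nlinarith [mul_pos hη (by linarith : 0 < N)]
  set s := Real.sin (h * k / 2) with hs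
  have hj0 : 0 < j := by linarith
  have hhj : 0 < h * j := by positivity
  have hhjk : h * j ≤ h * k := by gcongr
  have hs0 : 0 < s := Real.sin_pos_of_pos_of_lt_pi (by linarith) (by linarith)
  have hsk : 3 / 4 * (α - 1) ≤ α * s ^ 2 := by
    have := mul_le_mul_of_nonneg_left (sin_sq_mono hh hj0.le hjk hk') (by linarith : 0 ≤ α)
    linarith
  -- Here `α s² < (5/4)(α - 1)` and `(α - 1)/α ≤ 1/2`. So the inflection is far from the edge `hξ =
  -- π`, and the cosines are bounded below.
  have hs2 : s ^ 2 ≤ 5 / 8 := by nlinarith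
  have hc : 3 / 5 ≤ Real.cos (h * k / 2) := by
    have c0 : 0 ≤ Real.cos (h * k / 2) := Real.cos_nonneg_of_mem_Icc ⟨by linarith, by linarith⟩
    have := Real.sin_sq_add_cos_sq (h * k / 2)
    rw [← hs] at this
    nlinarith
  have hcj : 3 / 5 ≤ Real.cos (h * j / 2) :=
    hc.trans (Real.cos_le_cos_of_nonneg_of_le_pi (by linarith) (by linarith) (by linarith))
  have hsum : 3 / 5 * s ≤ Real.sin (h * k / 2 + h * j / 2) := by
    rw [Real.sin_add]
    have : 0 ≤ Real.sin (h * j / 2) :=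
      Real.sin_nonneg_of_nonneg_of_le_pi (by linarith) (by linarith)
    nlinarith
  have hdiff : h * (k - j) / Real.pi ≤ Real.sin (h * k / 2 - h * j / 2) := by
    calc h * (k - j) / Real.pi = 2 / Real.pi * (h * k / 2 - h * j / 2) := by ring
      _ ≤ _ := Real.mul_le_sin (by linarith) (by linarith)
  -- The factor with the sum is at least of order `s`, the one with the difference of order `h (k -
  -- j)`.
  have hid : s ^ 2 - Real.sin (h * j / 2) ^ 2 =
      Real.sin (h * k / 2 + h * j / 2) * Real.sin (h * k / 2 - h * j / 2) := by
    rw [Real.sin_add, Real.sin_sub, ← hs]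
    have e1 := Real.sin_sq_add_cos_sq (h * k / 2)
    have e2 := Real.sin_sq_add_cos_sq (h * j / 2)
    rw [← hs] at e1
    linear_combination Real.sin (h * j / 2) ^ 2 * e1 - s ^ 2 * e2
  have hd0 : 0 ≤ h * (k - j) / Real.pi := by
    have : 0 ≤ k - j := by linarith
    positivity
  have key : 3 / 5 * s * (h * (k - j) / Real.pi) ≤ s ^ 2 - Real.sin (h * j / 2) ^ 2 := by
    rw [hid]
    exact mul_le_mul hsum hdiff hd0 (le_trans (by positivity) hsum)
  -- This eliminates the mesh: `s h (k - j) ≥ s² (k - j) / N`, and `α s² ≥ (3/4)(α - 1)`.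
  have hhs : s ≤ h * N := by
    calc s ≤ h * k / 2 := Real.sin_le (by linarith)
      _ ≤ h * N := by nlinarith
  have k1 : 3 / 5 * s * (s * (k - j)) ≤ 3 / 5 * s * ((h * (k - j) / Real.pi) * (4 * N)) := by
    refine mul_le_mul_of_nonneg_left ?_ (by positivity)
    calc s * (k - j) ≤ (h * N) * (k - j) := by
          apply mul_le_mul_of_nonneg_right hhs; linarith
      _ = (h * (k - j) / Real.pi) * (Real.pi * N) := by field_simp
      _ ≤ _ := by
          refine mul_le_mul_of_nonneg_left ?_ hd0
          exact mul_le_mul_of_nonneg_right Real.pi_le_four (by linarith)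
  have k2 : α * (3 / 5 * s * (s * (k - j))) ≤ α * (s ^ 2 - Real.sin (h * j / 2) ^ 2) * (4 * N) := by
    have := mul_le_mul_of_nonneg_right key (by linarith : 0 ≤ 4 * N)
    have := mul_le_mul_of_nonneg_left (k1.trans (by linarith : _ ≤ (s ^ 2 - Real.sin (h * j / 2) ^ 2) * (4 * N))) (by linarith : 0 ≤ α)
    linarith
  have k3 : 3 / 4 * (α - 1) * (k - j) ≤ α * s ^ 2 * (k - j) := by
    apply mul_le_mul_of_nonneg_right hsk; linarith
  have k4 : α * (s ^ 2 - Real.sin (h * j / 2) ^ 2) * (4 * N) ≤ (2 * η) * (4 * N) := by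
    refine mul_le_mul_of_nonneg_right ?_ (by linarith)
    linarith
  nlinarith

/-! ### The dispersive estimate on a dyadic block -/

/-- Complex conjugation. It exchanges concave and convex phases and reverses time. -/
lemma norm_sum_exp_neg (φ : ℕ → ℝ) (s : Finset ℕ) :
    ‖∑ k ∈ s, Complex.exp (Complex.I * ((-φ k : ℝ) : ℂ))‖ =
      ‖∑ k ∈ s, Complex.exp (Complex.I * φ k)‖ := by
  rw [← Complex.norm_conj, map_sum]
  congr 1
  refine Finset.sum_congr rfl fun k _ => ?_
  rw [← Complex.exp_conj]
  congr 1
  simp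

/-- The second derivative test for the dispersive phase, where the dispersion relation is strictly
convex (`c = -1`) or strictly concave (`c = 1`). -/
lemma norm_sum_phase_le {h α t x μ c : ℝ} {p r : ℕ} (hh : 0 < h) (ht : 0 < t) (hμ : 0 < μ)
    (hc : c = 1 ∨ c = -1) (hp : 0 < p) (hr : ∀ k ∈ Finset.Ico p r, h * k ≤ Real.pi)
    (hx : |x| ≤ Real.pi)
    (hinc : ∀ k, p ≤ k → k + 1 < r → t * |chord h (k + 1) ^ α - chord h k ^ α| ≤ 1)
    (hder : ∀ ξ : ℝ, (p : ℝ) ≤ ξ → ξ + 1 ≤ r →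
      μ ≤ -c * (α * chord h ξ ^ (α - 2) * (α - 1 - α * Real.sin (h * ξ / 2) ^ 2))) :
    ‖∑ k ∈ Finset.Ico p r, Complex.exp (Complex.I * ((x * k - t * chord h k ^ α : ℝ) : ℂ))‖ ≤
      23 * (1 + (t * μ) ^ (-(1 / 2) : ℝ)) + 1 := by
  rcases le_or_gt r p with h0 | h0
  · simp only [Finset.Ico_eq_empty_of_le h0, Finset.sum_empty, norm_zero]; positivity
  -- The second derivative test looks at the phase at its right endpoint, so the last term is split
  -- off to keep every point in the range; it costs the final `+ 1`.
  obtain ⟨r, rfl⟩ : ∃ r', r = r' + 1 := ⟨r - 1, by omega⟩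
  rw [Finset.sum_Ico_succ_top (by omega)]
  refine (norm_add_le _ _).trans (add_le_add ?_ ?_)
  swap
  · rw [mul_comm, Complex.norm_exp_ofReal_mul_I]
  have hcc : |c| = 1 := by rcases hc with rfl | rfl <;> simp
  have e : ‖∑ k ∈ Finset.Ico p r, Complex.exp (Complex.I * ((x * k - t * chord h k ^ α : ℝ) : ℂ))‖
      = ‖∑ k ∈ Finset.Ico p r,
        Complex.exp (Complex.I * ((c * (x * k - t * chord h k ^ α) : ℝ) : ℂ))‖ := by
    rcases hc with rfl | rfl
    · simp only [one_mul]
    · simp only [neg_one_mul]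
      exact (norm_sum_exp_neg (fun k => x * k - t * chord h k ^ α) _).symm
  rw [e]
  refine second_difference_test (fun k => c * (x * k - t * chord h k ^ α)) (mul_pos ht hμ)
    (fun k hk => ?_) fun k hk hk' => ?_
  · rw [Finset.mem_Ico] at hk
    have h1 := hinc k hk.1 (by omega)
    have e1 : c * (x * ((k + 1 : ℕ) : ℝ) - t * chord h ((k + 1 : ℕ) : ℝ) ^ α) -
        c * (x * k - t * chord h k ^ α) =
        c * (x - t * (chord h (k + 1) ^ α - chord h k ^ α)) := by push_cast; ring
    rw [e1, abs_mul, hcc, one_mul]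
    refine (abs_sub _ _).trans ?_
    rw [abs_mul, abs_of_pos ht]
    linarith
  · have hk2 : h * ((k : ℝ) + 2) ≤ Real.pi := by
      have := hr (k + 2) (Finset.mem_Ico.2 ⟨by omega, by omega⟩)
      push_cast at this
      exact this
    have hkr : (k : ℝ) + 2 ≤ r := by exact_mod_cast (by omega : k + 2 ≤ r)
    have hpk : (p : ℝ) ≤ k := by exact_mod_cast hk
    have hp1 : (1 : ℝ) ≤ p := by exact_mod_cast hp
    have hI : ∀ y ∈ Set.Icc (k : ℝ) (k + 2), 0 < y ∧ h * y ≤ Real.pi := fun y hy =>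
      ⟨by linarith [hy.1], (mul_le_mul_of_nonneg_left hy.2 hh.le).trans hk2⟩
    have := le_second_difference (f := fun y => -c * chord h y ^ α)
      (f' := fun y => -c * (α * chord h y ^ (α - 1) * Real.cos (h * y / 2)))
      (f'' := fun y => -c * (α * chord h y ^ (α - 2) * (α - 1 - α * Real.sin (h * y / 2) ^ 2)))
      (fun y hy => (hasDerivAt_chord_rpow hh (hI y hy).1 (hI y hy).2).const_mul _)
      (fun y hy => (hasDerivAt_deriv_chord_rpow hh (hI y hy).1 (hI y hy).2).const_mul _)
      (fun y hy => hder y (hpk.trans hy.1) (by push_cast; linarith [hy.2]))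
    have := mul_le_mul_of_nonneg_left this ht.le
    push_cast
    linarith

/-- The dispersive estimate for one dyadic block and normalized `x`. -/
lemma dispersive_estimate_normalized {h α t x b : ℝ} {N L : ℕ} (hh : 0 < h) (hα : 1 < α) (hα2 : α ≤ 2)
    (hN : 1 ≤ N) (hL : L ≤ 2 * N) (hL' : ∀ k ∈ Finset.Ico N L, h * k ≤ Real.pi)
    (ht : 0 < t) (ht' : t * (4 * (N : ℝ) ^ (α - 1)) ≤ 1) (hx : |x| ≤ Real.pi)
    (hb : 0 < b) (hb3 : b ^ 3 = (α - 1) * (t * (N : ℝ) ^ (α - 2)) / N) :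
    ‖∑ k ∈ Finset.Ico N L, Complex.exp (Complex.I * ((x * k - t * chord h k ^ α : ℝ) : ℂ))‖ ≤
      200 / b := by
  rcases le_or_gt L N with h0 | h0
  · simp only [Finset.Ico_eq_empty_of_le h0, Finset.sum_empty, norm_zero]; positivity
  have hN1 : (1 : ℝ) ≤ N := by exact_mod_cast hN
  have hN0 : (0 : ℝ) < N := by linarith
  have hL2 : (L : ℝ) ≤ 2 * N := by exact_mod_cast hL
  have ha : 0 < α - 1 := by linarith
  set T := t * (N : ℝ) ^ (α - 2) with hT
  have hT0 : 0 < T := by positivity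
  -- Within `η` of the inflection there are about `ηN/(α - 1)` terms; outside, the test costs
  -- `(Tη)^(-1/2)`. This `η` makes both of order `1/b`.
  set η := b ^ 2 / T with hη
  have hη0 : 0 < η := by positivity
  have hηN : η * N / (α - 1) = 1 / b := by
    rw [hη]
    field_simp at hb3 ⊢
    linarith
  -- Lets `1/b` absorb the additive constants of the three estimates.
  have hb1 : b ≤ 1 := by
    have hTN : T * N ≤ 1 := by
      have : T * N = t * (N : ℝ) ^ (α - 1) := by
        rw [hT, mul_assoc, ← Real.rpow_add_one hN0.ne']; congr 2; ring
      have h2 : 0 ≤ t * (N : ℝ) ^ (α - 1) := by positivity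
      linarith
    have hT1 : T ≤ 1 := by nlinarith
    have : b ^ 3 ≤ 1 := by
      rw [hb3, div_le_one hN0]
      nlinarith
    by_contra! hcon
    nlinarith [mul_pos hb hb]
  set μ := (N : ℝ) ^ (α - 2) / 2 * η with hμ
  have hμ0 : 0 < μ := by positivity
  have htμ : (t * μ) ^ (-(1 / 2) : ℝ) ≤ 2 / b := by
    have e : t * μ = b ^ 2 / 2 := by
      rw [hμ, hη, hT]; field_simp
    have e2 : (b / 2) ^ 2 ≤ t * μ := by rw [e]; nlinarith
    calc (t * μ) ^ (-(1 / 2) : ℝ) ≤ ((b / 2) ^ 2) ^ (-(1 / 2) : ℝ) :=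
          Real.rpow_le_rpow_of_nonpos (by positivity) e2 (by norm_num)
      _ = 2 / b := by
          rw [← Real.rpow_natCast, ← Real.rpow_mul (by positivity)]
          norm_num
          rw [Real.rpow_neg_one, inv_div]
  have hinc : ∀ k, N ≤ k → k + 1 < L → t * |chord h (k + 1) ^ α - chord h k ^ α| ≤ 1 :=
    fun k hk hk' => by
      have hπ := hL' (k + 1) (Finset.mem_Ico.2 ⟨by omega, hk'⟩)
      push_cast at hπ
      refine (mul_le_mul_of_nonneg_left (abs_increment_le hh hα hα2 hN1 ?_ ?_ hπ) ht.le).trans ht'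
      · exact_mod_cast hk
      · exact_mod_cast (by omega : k + 1 ≤ 2 * N)
  have hmono : ∀ k, N ≤ k → k + 1 < L →
      α * Real.sin (h * (k : ℝ) / 2) ^ 2 ≤ α * Real.sin (h * ((k + 1 : ℕ) : ℝ) / 2) ^ 2 :=
    fun k hk hk' => mul_le_mul_of_nonneg_left (sin_sq_mono hh (by positivity)
      (by push_cast; linarith) (hL' (k + 1) (Finset.mem_Ico.2 ⟨by omega, hk'⟩))) (by linarith)
  -- Monotonicity of `sin²` cuts the block into convex, nearly degenerate and concave ranges.
  obtain ⟨m₁, a1, a2, a3, a4⟩ := exists_threshold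
    (fun k : ℕ => α - 1 - η < α * Real.sin (h * (k : ℝ) / 2) ^ 2) h0.le
    fun k hk hk' hP => hP.trans_le (hmono k hk hk')
  obtain ⟨m₂, c1, c2, c3, c4⟩ := exists_threshold
    (fun k : ℕ => α - 1 + η ≤ α * Real.sin (h * (k : ℝ) / 2) ^ 2) a2
    fun k hk hk' hP => hP.trans (hmono k (a1.trans hk) hk')
  simp only [not_lt, not_le] at a3 c3
  have hlow : ∀ ξ : ℝ, (N : ℝ) ≤ ξ → ξ + 1 ≤ L →
      h * ξ ≤ Real.pi ∧ (N : ℝ) ^ (α - 2) / 2 ≤ α * chord h ξ ^ (α - 2) := fun ξ h1 h2 => by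
    have hπ := hL' (L - 1) (Finset.mem_Ico.2 ⟨by omega, by omega⟩)
    rw [Nat.cast_sub (by omega)] at hπ
    have hle : h * ξ ≤ Real.pi :=
      (mul_le_mul_of_nonneg_left (by push_cast; linarith) hh.le).trans hπ
    exact ⟨hle, half_rpow_le_chord_rpow hh hα hα2 hN1 (by linarith) (by linarith) hle⟩
  have s1 := norm_sum_phase_le (α := α) (x := x) (c := -1) (p := N) (r := m₁) hh ht hμ0
    (Or.inr rfl) hN (fun k hk => hL' k (Finset.Ico_subset_Ico_right a2 hk)) hx
    (fun k hk hk' => hinc k hk (by omega)) fun ξ h1 h2 => by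
      have hm : N < m₁ := by
        have : (N : ℝ) < m₁ := by linarith
        exact_mod_cast this
      have hm1 : m₁ - 1 ∈ Finset.Ico N m₁ := Finset.mem_Ico.2 ⟨by omega, by omega⟩
      have b1 := a3 (m₁ - 1) hm1
      have b2 := sin_sq_mono (x := ξ) (y := ((m₁ - 1 : ℕ) : ℝ)) hh (by linarith)
        (by rw [Nat.cast_sub (by omega)]; push_cast; linarith)
        (hL' (m₁ - 1) (Finset.Ico_subset_Ico_right a2 hm1))
      have b3 := mul_le_mul_of_nonneg_left b2 (by linarith : 0 ≤ α)
      have hm2 : (m₁ : ℝ) ≤ L := by exact_mod_cast a2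
      rw [neg_neg, one_mul]
      exact mul_le_mul (hlow ξ h1 (by linarith)).2 (by linarith) hη0.le
        (le_trans (by positivity) (hlow ξ h1 (by linarith)).2)
  have s3 := norm_sum_phase_le (α := α) (x := x) (c := 1) (p := m₂) (r := L) hh ht hμ0
    (Or.inl rfl) (by omega) (fun k hk => hL' k (Finset.Ico_subset_Ico_left (a1.trans c1) hk)) hx
    (fun k hk hk' => hinc k (by omega) hk') fun ξ h1 h2 => by
      have hm : m₂ < L := by
        have : (m₂ : ℝ) < L := by linarith
        exact_mod_cast this
      have hNm : (N : ℝ) ≤ m₂ := by exact_mod_cast a1.trans c1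
      have b1 := c4 m₂ (Finset.mem_Ico.2 ⟨le_rfl, hm⟩)
      have hl := hlow ξ (by linarith) h2
      have b2 := sin_sq_mono (x := (m₂ : ℝ)) (y := ξ) hh (by positivity) h1 hl.1
      have b3 := mul_le_mul_of_nonneg_left b2 (by linarith : 0 ≤ α)
      rw [neg_one_mul, ← mul_neg]
      exact mul_le_mul hl.2 (by linarith) hη0.le (le_trans (by positivity) hl.2)
  have s2 : ‖∑ k ∈ Finset.Ico m₁ m₂,
      Complex.exp (Complex.I * ((x * k - t * chord h k ^ α : ℝ) : ℂ))‖ ≤ 40 * (1 / b) + 1 := by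
    refine (norm_sum_exp_le_card (fun k : ℕ => x * k - t * chord h k ^ α) _).trans ?_
    rw [Nat.card_Ico]
    rcases c1.eq_or_lt with e | hlt
    · rw [e]; simp; positivity
    have hm1 : m₁ ∈ Finset.Ico m₁ L := Finset.mem_Ico.2 ⟨le_rfl, by omega⟩
    have hm2 : m₂ - 1 ∈ Finset.Ico m₁ m₂ := Finset.mem_Ico.2 ⟨by omega, by omega⟩
    have hlen := near_degenerate_length (j := (m₁ : ℝ)) (k := ((m₂ - 1 : ℕ) : ℝ)) hh hα hα2 hη0 hN1
      (by exact_mod_cast a1) (by exact_mod_cast (by omega : m₁ ≤ m₂ - 1))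
      (by exact_mod_cast (by omega : m₂ - 1 ≤ 2 * N))
      (hL' _ (Finset.mem_Ico.2 ⟨by omega, by omega⟩)) (a4 m₁ hm1) (c3 _ hm2)
    rw [hηN] at hlen
    rw [Nat.cast_sub c1]
    rw [Nat.cast_sub (by omega)] at hlen
    push_cast at hlen
    linarith
  have hb' : 1 ≤ 1 / b := by rw [le_div_iff₀ hb]; linarith
  have e2 : 2 / b = 2 * (1 / b) := by ring
  have e3 : 200 / b = 200 * (1 / b) := by ring
  rw [← Finset.sum_Ico_consecutive _ (a1.trans c1) c2, ← Finset.sum_Ico_consecutive _ a1 c1, e3]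
  refine norm_add₃_le.trans ?_
  linarith

/-- The dispersive estimate for one dyadic block. -/
lemma dispersive_estimate {h α : ℝ} {N L : ℕ} (hh : 0 < h) (hα : 1 < α) (hα2 : α ≤ 2)
    (hN : 1 ≤ N) (hL : L ≤ 2 * N) (hL' : ∀ k ∈ Finset.Ico N L, h * k ≤ Real.pi)
    (t x : ℝ) (ht : t ≠ 0) (ht' : |t| * (4 * (N : ℝ) ^ (α - 1)) ≤ 1) :
    ‖∑ k ∈ Finset.Ico N L, Complex.exp (Complex.I * ((x * k - t * chord h k ^ α : ℝ) : ℂ))‖ ≤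
      200 * ((α - 1) * (N : ℝ) ^ (α - 3)) ^ (-(1 / 3) : ℝ) * |t| ^ (-(1 / 3) : ℝ) := by
  wlog htp : 0 < t generalizing t x
  · have := this (-t) (-x) (neg_ne_zero.2 ht) (by rwa [abs_neg])
      (neg_pos.2 (lt_of_le_of_ne (not_lt.1 htp) ht))
    rw [abs_neg] at this
    refine le_trans (le_of_eq ?_) this
    rw [← norm_sum_exp_neg]
    congr! 5
    ring
  have hN0 : (0 : ℝ) < N := by exact_mod_cast hN
  have ha : 0 < α - 1 := by linarith
  rw [abs_of_pos htp] at ht' ⊢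
  -- The frequencies are integers, so `x` matters only modulo `2π`.
  set m := round (x / (2 * Real.pi)) with hm
  have hx : |x - m * (2 * Real.pi)| ≤ Real.pi := by
    have := abs_sub_round (x / (2 * Real.pi))
    have e : x - m * (2 * Real.pi) = (x / (2 * Real.pi) - m) * (2 * Real.pi) := by
      field_simp
    rw [e, abs_mul, abs_of_pos Real.two_pi_pos]
    nlinarith [Real.pi_pos]
  have e : ∀ k : ℕ, Complex.exp (Complex.I * ((x * k - t * chord h k ^ α : ℝ) : ℂ)) =
      Complex.exp (Complex.I * (((x - m * (2 * Real.pi)) * k - t * chord h k ^ α : ℝ) : ℂ)) :=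
    fun k => by
      rw [show Complex.I * ((x * k - t * chord h k ^ α : ℝ) : ℂ) =
        Complex.I * (((x - m * (2 * Real.pi)) * k - t * chord h k ^ α : ℝ) : ℂ) +
          ((m * k : ℤ) : ℂ) * (2 * Real.pi * Complex.I) by push_cast; ring, Complex.exp_add,
        Complex.exp_int_mul_two_pi_mul_I, mul_one]
  simp only [e]
  set y := (α - 1) * (N : ℝ) ^ (α - 3) * t with hy
  have hy0 : 0 < y := by positivity
  refine (dispersive_estimate_normalized (b := y ^ (1 / 3 : ℝ)) hh hα hα2 hN hL hL' htp ht' hx (by positivity)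
    ?_).trans (le_of_eq ?_)
  · rw [← Real.rpow_natCast, ← Real.rpow_mul hy0.le, hy, show α - 2 = α - 3 + 1 by ring,
      Real.rpow_add_one hN0.ne']
    norm_num
    field_simp
  · rw [mul_assoc, ← Real.mul_rpow (by positivity) htp.le, ← hy, Real.rpow_neg hy0.le]
    rfl

/-! ### From a dispersive estimate to a large value estimate -/

lemma lintegral_indicator_rpow {δ : ℝ} (hδ : 0 < δ) :
    ∫⁻ u, (Set.Ioc 0 δ).indicator (fun u => ENNReal.ofReal (u ^ (-(1 / 3) : ℝ))) u =
      ENNReal.ofReal (3 / 2 * δ ^ (2 / 3 : ℝ)) := by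
  rw [lintegral_indicator measurableSet_Ioc, ← ofReal_integral_eq_lintegral_ofReal]
  · rw [← intervalIntegral.integral_of_le hδ.le, integral_rpow (Or.inl (by norm_num))]
    congr 1
    rw [Real.zero_rpow (by norm_num)]
    norm_num
    ring
  · exact (intervalIntegrable_iff_integrableOn_Ioc_of_le hδ.le).1
      (intervalIntegral.intervalIntegrable_rpow' (by norm_num))
  · exact (ae_restrict_iff' measurableSet_Ioc).2 (ae_of_all _ fun u hu => Real.rpow_nonneg hu.1.le _)

/-- The singular kernel `|t - s|^{-1/3}` integrated over a set of given measure. -/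
lemma setLIntegral_singular_le {E : Set ℝ} {m : ℝ} (hm : 0 < m) (hE : volume E = ENNReal.ofReal m)
    (t : ℝ) :
    ∫⁻ s in E, ENNReal.ofReal (|t - s| ^ (-(1 / 3) : ℝ)) ≤
      ENNReal.ofReal (4 * m ^ (2 / 3 : ℝ)) := by
  set g : ℝ → ℝ≥0∞ :=
    (Set.Ioc 0 m).indicator (fun u => ENNReal.ofReal (u ^ (-(1 / 3) : ℝ))) with hg
  have hgm : Measurable g :=
    (Measurable.indicator (by fun_prop) measurableSet_Ioc)
  -- Beyond distance `m` the kernel is at most `m^(-1/3)`, which contributes `m^(2/3)` over `E`;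
  -- each side of the singularity contributes `3/2 m^(2/3)`.
  have hpt : ∀ s, ENNReal.ofReal (|t - s| ^ (-(1 / 3) : ℝ)) ≤
      ENNReal.ofReal (m ^ (-(1 / 3) : ℝ)) + (g (t - s) + g (-(t - s))) := fun s => by
    rcases le_or_gt m |t - s| with h | h
    · refine le_add_right (ENNReal.ofReal_le_ofReal ?_)
      exact Real.rpow_le_rpow_of_nonpos hm h (by norm_num)
    · refine le_add_left ?_
      rcases lt_trichotomy (t - s) 0 with h0 | h0 | h0
      · rw [abs_of_neg h0] at h ⊢
        refine le_add_left (le_of_eq ?_)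
        rw [hg, Set.indicator_of_mem (Set.mem_Ioc.2 ⟨by linarith, h.le⟩)]
      -- On the diagonal the real power takes the default value `0`.
      · rw [h0, abs_zero, Real.zero_rpow (by norm_num)]
        simp
      · rw [abs_of_pos h0] at h ⊢
        refine le_add_right (le_of_eq ?_)
        rw [hg, Set.indicator_of_mem (Set.mem_Ioc.2 ⟨h0, h.le⟩)]
  calc ∫⁻ s in E, ENNReal.ofReal (|t - s| ^ (-(1 / 3) : ℝ))
      ≤ ∫⁻ s in E, (ENNReal.ofReal (m ^ (-(1 / 3) : ℝ)) + (g (t - s) + g (-(t - s)))) :=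
        lintegral_mono hpt
    _ = ENNReal.ofReal (m ^ (-(1 / 3) : ℝ)) * volume E + ∫⁻ s in E, (g (t - s) + g (-(t - s))) := by
        rw [lintegral_add_left measurable_const, setLIntegral_const]
    _ ≤ ENNReal.ofReal (m ^ (-(1 / 3) : ℝ)) * volume E + ∫⁻ s, (g (t - s) + g (-(t - s))) := by
        exact add_le_add le_rfl (setLIntegral_le_lintegral _ _)
    _ = ENNReal.ofReal (m ^ (-(1 / 3) : ℝ) * m) +
          (ENNReal.ofReal (3 / 2 * m ^ (2 / 3 : ℝ)) + ENNReal.ofReal (3 / 2 * m ^ (2 / 3 : ℝ))) := by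
        rw [lintegral_add_left (by fun_prop), lintegral_sub_left_eq_self g,
          lintegral_sub_left_eq_self (fun u => g (-u)), lintegral_neg_eq_self, hE,
          ← ENNReal.ofReal_mul (by positivity), hg, lintegral_indicator_rpow hm]
    _ = _ := by
        rw [← ENNReal.ofReal_add (by positivity) (by positivity),
          ← ENNReal.ofReal_add (by positivity) (by positivity), ← Real.rpow_add_one hm.ne']
        congr 1
        norm_num
        ring

section

variable {H : Type*} [NormedAddCommGroup H] [InnerProductSpace ℂ H] [CompleteSpace H]

/-- The `TT*` step: the square is the double integral of `⟨Ψ t, Ψ s⟩`. The diagonal is null, the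
inner integral is at most `4 A m^(2/3)`, and the outer one adds a factor `m`. -/
lemma norm_sq_setIntegral_le {E : Set ℝ} (hE : MeasurableSet E) {m A : ℝ} (hm : 0 < m)
    (hEm : volume E = ENNReal.ofReal m) (hA : 0 ≤ A) {Ψ : ℝ → H} (hΨ : IntegrableOn Ψ E)
    (hker : ∀ t ∈ E, ∀ s ∈ E, t ≠ s → ‖inner ℂ (Ψ t) (Ψ s)‖ ≤ A * |t - s| ^ (-(1 / 3) : ℝ)) :
    ‖∫ t in E, Ψ t‖ ^ 2 ≤ 4 * A * m ^ (5 / 3 : ℝ) := by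
  set V := ∫ t in E, Ψ t with hV
  have h1 : ∀ t ∈ E, ‖inner ℂ V (Ψ t)‖ₑ ≤ ENNReal.ofReal (A * (4 * m ^ (2 / 3 : ℝ))) := fun t ht => by
    rw [← enorm_norm, norm_inner_symm, enorm_norm, hV, ← integral_inner hΨ]
    refine (enorm_integral_le_lintegral_enorm _).trans ?_
    rw [ENNReal.ofReal_mul hA]
    refine le_trans ?_ (mul_le_mul_right (setLIntegral_singular_le hm hEm t) _)
    rw [← lintegral_const_mul _ (by fun_prop)]
    refine lintegral_mono_ae ?_
    have hne : ∀ᵐ s ∂(volume.restrict E), s ≠ t := by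
      refine ae_restrict_of_ae ?_
      simp [ae_iff, measure_singleton]
    filter_upwards [ae_restrict_mem hE, hne] with s hs hst
    rw [← ENNReal.ofReal_mul hA, ← ofReal_norm]
    exact ENNReal.ofReal_le_ofReal (hker t ht s hs hst.symm)
  have h2 : ‖inner ℂ V V‖ₑ ≤ ENNReal.ofReal (A * (4 * m ^ (2 / 3 : ℝ)) * m) := by
    conv_lhs => rw [hV, ← integral_inner hΨ, ← hV]
    refine (enorm_integral_le_lintegral_enorm _).trans ?_
    rw [ENNReal.ofReal_mul (by positivity), ← hEm, ← setLIntegral_const]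
    refine lintegral_mono_ae ?_
    filter_upwards [ae_restrict_mem hE] with t ht using h1 t ht
  rw [← ofReal_norm, ENNReal.ofReal_le_ofReal_iff (by positivity),
    inner_self_eq_norm_sq_to_K] at h2
  norm_num at h2
  have e : m ^ (5 / 3 : ℝ) = m ^ (2 / 3 : ℝ) * m := by
    rw [← Real.rpow_add_one hm.ne']; norm_num
  rw [e]
  linarith

/-- The large value estimate on a short time interval. -/
lemma large_values_short {J : Type*} [Fintype J] (v : ℝ → J → H)
    (hv : ∀ j, Continuous fun t => v t j) {R : ℝ} (hR : ∀ t j, ‖v t j‖ ≤ R) {A lam : ℝ}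
    (hA : 0 ≤ A) (hlam : 0 < lam) (c : H) {E : Set ℝ} (hE : MeasurableSet E)
    (hEf : volume E ≠ ∞)
    (hker : ∀ t ∈ E, ∀ s ∈ E, t ≠ s → ∀ i j,
      ‖inner ℂ (v t i) (v s j)‖ ≤ A * |t - s| ^ (-(1 / 3) : ℝ))
    (hlarge : ∀ t ∈ E, ∃ j, lam ≤ ‖inner ℂ (v t j) c‖) :
    lam ^ 6 * volume.real E ≤ 64 * A ^ 3 * ‖c‖ ^ 6 := by
  classical
  rcases eq_or_ne (volume E) 0 with h0 | h0
  · rw [Measure.real, h0]; simp; positivity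
  set m := volume.real E with hm
  have hm0 : 0 < m := ENNReal.toReal_pos h0 hEf
  have hEm : volume E = ENNReal.ofReal m := (ENNReal.ofReal_toReal hEf).symm
  set z : J → ℝ → ℂ := fun j t => inner ℂ (v t j) c with hz
  have hzc : ∀ j, Continuous (z j) := fun j => (hv j).inner continuous_const
  set S : J → Set ℝ := fun j => {t | lam ≤ ‖z j t‖} with hS
  have hSm : ∀ j, MeasurableSet (S j) := fun j =>
    measurableSet_le measurable_const (hzc j).norm.measurable
  set n : ℝ → ℝ := fun t => ∑ j, (S j).indicator 1 t with hn
  have hnm : Measurable n := Finset.measurable_sum _ fun j _ => measurable_one.indicator (hSm j)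
  -- The phases of `⟨v t j, c⟩`, averaged over all `j` where it is large: a measurable substitute
  -- for selecting one such point. The weights have `ℓ¹` norm at most `1`, so `Ψ` inherits the
  -- kernel bound.
  set w : J → ℝ → ℂ := fun j t =>
    (S j).indicator (fun t => z j t / (‖z j t‖ : ℂ)) t * ((n t)⁻¹ : ℝ) with hw
  have hwm : ∀ j, Measurable (w j) := fun j => by
    refine Measurable.mul (Measurable.indicator ?_ (hSm j)) ?_
    · exact (hzc j).measurable.div (Complex.measurable_ofReal.comp (hzc j).norm.measurable)
    · exact Complex.measurable_ofReal.comp hnm.inv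
  have hn0 : ∀ t, 0 ≤ n t := fun t => Finset.sum_nonneg fun j _ =>
    Set.indicator_nonneg (fun _ _ => zero_le_one) _
  have hwn : ∀ j t, ‖w j t‖ = (S j).indicator 1 t * (n t)⁻¹ := fun j t => by
    rw [hw]
    simp only [norm_mul, Complex.norm_real, Real.norm_eq_abs, abs_inv, abs_of_nonneg (hn0 t)]
    congr 1
    by_cases ht : t ∈ S j
    · rw [Set.indicator_of_mem ht, Set.indicator_of_mem ht, norm_div, Complex.norm_real, norm_norm,
        Pi.one_apply, div_self]
      exact (hlam.trans_le ht).ne'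
    · rw [Set.indicator_of_notMem ht, Set.indicator_of_notMem ht, norm_zero]
  have hwsum : ∀ t, ∑ j, ‖w j t‖ ≤ 1 := fun t => by
    simp only [hwn]
    rw [← Finset.sum_mul]
    exact mul_inv_le_one
  have hnpos : ∀ t ∈ E, 0 < n t := fun t ht => by
    obtain ⟨j, hj⟩ := hlarge t ht
    refine Finset.sum_pos' (fun j _ => Set.indicator_nonneg (fun _ _ => zero_le_one) _)
      ⟨j, Finset.mem_univ _, ?_⟩
    rw [Set.indicator_of_mem (show t ∈ S j from hj)]
    exact one_pos
  set Ψ : ℝ → H := fun t => ∑ j, w j t • v t j with hΨ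
  have hΨi : IntegrableOn Ψ E := by
    refine integrable_finsetSum _ fun j _ => ?_
    refine Measure.integrableOn_of_bounded (M := R) hEf
      ((hwm j).aestronglyMeasurable.smul (hv j).aestronglyMeasurable) (ae_of_all _ fun t => ?_)
    rw [norm_smul]
    have h1 : ‖w j t‖ ≤ 1 := (Finset.single_le_sum (fun i _ => norm_nonneg (w i t))
      (Finset.mem_univ j)).trans (hwsum t)
    exact (mul_le_of_le_one_left (norm_nonneg _) h1).trans (hR t j)
  have hΨk : ∀ t ∈ E, ∀ s ∈ E, t ≠ s →
      ‖inner ℂ (Ψ t) (Ψ s)‖ ≤ A * |t - s| ^ (-(1 / 3) : ℝ) := fun t ht s hs hts => by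
    have hK : 0 ≤ A * |t - s| ^ (-(1 / 3) : ℝ) := by positivity
    simp only [hΨ, sum_inner, inner_sum, inner_smul_left, inner_smul_right]
    calc _ ≤ ∑ i, ∑ j, ‖w j t‖ * (‖w i s‖ * (A * |t - s| ^ (-(1 / 3) : ℝ))) := by
          refine (norm_sum_le _ _).trans (Finset.sum_le_sum fun i _ => ?_)
          rw [Finset.mul_sum]
          refine (norm_sum_le _ _).trans (Finset.sum_le_sum fun j _ => ?_)
          rw [norm_mul (w i s), norm_mul (starRingEnd ℂ (w j t)), RCLike.norm_conj, mul_left_comm]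
          gcongr
          exact hker t ht s hs hts j i
      _ = (∑ j, ‖w j t‖) * ((∑ i, ‖w i s‖) * (A * |t - s| ^ (-(1 / 3) : ℝ))) := by
          simp only [← Finset.sum_mul, ← Finset.mul_sum]
      _ ≤ 1 * (1 * (A * |t - s| ^ (-(1 / 3) : ℝ))) := by
          gcongr
          · exact hwsum t
          · exact hwsum s
      _ = _ := by ring
  have hlow : ∀ t ∈ E, lam ≤ RCLike.re (inner ℂ c (Ψ t)) := fun t ht => by
    simp only [hΨ, inner_sum, inner_smul_right, map_sum]
    have e : ∀ j, RCLike.re (w j t * inner ℂ c (v t j)) =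
        (S j).indicator 1 t * (n t)⁻¹ * ‖z j t‖ := fun j => by
      have hcz : inner ℂ c (v t j) = starRingEnd ℂ (z j t) := (inner_conj_symm _ _).symm
      rw [hcz]
      simp only [hw]
      by_cases htj : t ∈ S j
      · have hne : (‖z j t‖ : ℂ) ≠ 0 := by exact_mod_cast (hlam.trans_le htj).ne'
        rw [Set.indicator_of_mem htj, Set.indicator_of_mem htj]
        have : z j t / (‖z j t‖ : ℂ) * ((n t)⁻¹ : ℝ) * starRingEnd ℂ (z j t) =
            (((n t)⁻¹ * ‖z j t‖ : ℝ) : ℂ) := by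
          have hh := Complex.mul_conj' (z j t)
          push_cast
          field_simp
          linear_combination ((n t : ℂ))⁻¹ * hh
        rw [this]
        simp
      · rw [Set.indicator_of_notMem htj, Set.indicator_of_notMem htj]
        simp
    simp only [e]
    calc lam = ∑ j, (S j).indicator 1 t * (n t)⁻¹ * lam := by
          rw [← Finset.sum_mul, ← Finset.sum_mul]
          rw [show ∑ j, (S j).indicator 1 t = n t from rfl, mul_inv_cancel₀ (hnpos t ht).ne', one_mul]
      _ ≤ _ := by
          refine Finset.sum_le_sum fun j _ => ?_
          by_cases htj : t ∈ S j
          · have hz : lam ≤ ‖z j t‖ := htj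
            have := hn0 t
            rw [Set.indicator_of_mem htj, Pi.one_apply]
            gcongr
          · rw [Set.indicator_of_notMem htj]; simp
  set V := ∫ t in E, Ψ t with hV
  have h1 : lam * m ≤ ‖c‖ * ‖V‖ := by
    have hint : IntegrableOn (fun t => inner ℂ c (Ψ t)) E := hΨi.const_inner c
    calc lam * m = ∫ _ in E, lam := by rw [setIntegral_const, smul_eq_mul, mul_comm]
      _ ≤ ∫ t in E, RCLike.re (inner ℂ c (Ψ t)) :=
          setIntegral_mono_on (integrableOn_const hEf) hint.re hE hlow
      _ = RCLike.re (inner ℂ c V) := by rw [integral_re hint, integral_inner hΨi]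
      _ ≤ _ := re_inner_le_norm c V
  have h2 := norm_sq_setIntegral_le hE hm0 hEm hA hΨi hΨk
  rw [← hV] at h2
  have h3 : lam ^ 2 * m ^ 2 ≤ ‖c‖ ^ 2 * (4 * A * m ^ (5 / 3 : ℝ)) := by
    calc lam ^ 2 * m ^ 2 = (lam * m) ^ 2 := by ring
      _ ≤ (‖c‖ * ‖V‖) ^ 2 := by gcongr
      _ = ‖c‖ ^ 2 * ‖V‖ ^ 2 := by ring
      _ ≤ _ := by gcongr
  have e5 : (m ^ (5 / 3 : ℝ)) ^ 3 = m ^ 5 := by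
    rw [← Real.rpow_natCast, ← Real.rpow_mul hm0.le]
    norm_num
  -- Cubing clears the fractional power, and `m^5` cancels.
  have h4 : (lam ^ 6 * m) * m ^ 5 ≤ (64 * A ^ 3 * ‖c‖ ^ 6) * m ^ 5 := by
    calc (lam ^ 6 * m) * m ^ 5 = (lam ^ 2 * m ^ 2) ^ 3 := by ring
      _ ≤ (‖c‖ ^ 2 * (4 * A * m ^ (5 / 3 : ℝ))) ^ 3 := by gcongr
      _ = 64 * A ^ 3 * ‖c‖ ^ 6 * (m ^ (5 / 3 : ℝ)) ^ 3 := by ring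
      _ = _ := by rw [e5]
  exact le_of_mul_le_mul_right h4 (by positivity)

/-- The large value estimate on the unit time interval. -/
lemma large_values {J : Type*} [Fintype J] (v : ℝ → J → H)
    (hv : ∀ j, Continuous fun t => v t j) {R : ℝ} (hR : ∀ t j, ‖v t j‖ ≤ R) {A lam τ : ℝ}
    (hA : 0 ≤ A) (hlam : 0 < lam) (hτ : 0 < τ) (hτ1 : τ ≤ 1)
    (hker : ∀ t s, t ≠ s → |t - s| ≤ τ → ∀ i j,
      ‖inner ℂ (v t i) (v s j)‖ ≤ A * |t - s| ^ (-(1 / 3) : ℝ)) (c : H) :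
    lam ^ 6 * volume.real ({t | ∃ j, lam ≤ ‖inner ℂ (v t j) c‖} ∩ Set.Icc 0 1) ≤
      192 / τ * A ^ 3 * ‖c‖ ^ 6 := by
  set E : Set ℝ := {t | ∃ j, lam ≤ ‖inner ℂ (v t j) c‖} with hE
  have hEm : MeasurableSet E := by
    rw [hE, Set.ofPred_exists]
    exact MeasurableSet.iUnion fun j => measurableSet_le measurable_const
      ((hv j).inner continuous_const).norm.measurable
  set n := ⌈1 / τ⌉₊ with hn
  set I : ℕ → Set ℝ := fun i => Set.Icc (i * τ) ((i + 1) * τ) with hI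
  have hcover : E ∩ Set.Icc 0 1 ⊆ ⋃ i ∈ Finset.range (n + 1), E ∩ I i := fun t ht => by
    have h0 : 0 ≤ t / τ := div_nonneg ht.2.1 hτ.le
    refine Set.mem_biUnion (x := ⌊t / τ⌋₊) ?_ ⟨ht.1, ?_, ?_⟩
    · refine Finset.mem_coe.2 (Finset.mem_range.2 (Nat.lt_succ_of_le ?_))
      refine (Nat.floor_le_ceil _).trans (Nat.ceil_le_ceil ?_)
      gcongr
      exact ht.2.2
    · rw [← le_div_iff₀ hτ]; exact Nat.floor_le h0
    · rw [← div_le_iff₀ hτ]; exact (Nat.lt_floor_add_one _).le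
  have hshort : ∀ i, lam ^ 6 * volume.real (E ∩ I i) ≤ 64 * A ^ 3 * ‖c‖ ^ 6 := fun i =>
    large_values_short v hv hR hA hlam c (hEm.inter measurableSet_Icc)
      (measure_ne_top_of_subset Set.inter_subset_right (by simp [hI]))
      (fun t ht s hs hts => hker t s hts (by
        obtain ⟨⟨-, t1, t2⟩, -, s1, s2⟩ := And.intro ht hs
        rw [abs_le]
        constructor <;> linarith))
      fun t ht => ht.1
  -- At most `3/τ` intervals of length `τ`, whence `192 = 3 · 64`.
  have hnτ : ((n + 1 : ℕ) : ℝ) ≤ 3 / τ := by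
    have h1 : (n : ℝ) < 1 / τ + 1 := Nat.ceil_lt_add_one (by positivity)
    have h2 : 1 ≤ 1 / τ := by rw [le_div_iff₀ hτ]; linarith
    have h3 : 3 / τ = 3 * (1 / τ) := by ring
    push_cast
    linarith
  calc lam ^ 6 * volume.real (E ∩ Set.Icc 0 1)
      ≤ lam ^ 6 * ∑ i ∈ Finset.range (n + 1), volume.real (E ∩ I i) := by
        gcongr
        refine (measureReal_mono hcover ?_).trans (measureReal_biUnion_finset_le _ _)
        refine ((measure_biUnion_finset_le _ _).trans_lt (ENNReal.sum_lt_top.2 fun i _ => ?_)).ne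
        exact (measure_mono Set.inter_subset_right).trans_lt (by simp [hI])
    _ = ∑ i ∈ Finset.range (n + 1), lam ^ 6 * volume.real (E ∩ I i) := Finset.mul_sum _ _ _
    _ ≤ ∑ i ∈ Finset.range (n + 1), 64 * A ^ 3 * ‖c‖ ^ 6 := Finset.sum_le_sum fun i _ => hshort i
    _ = ((n + 1 : ℕ) : ℝ) * (64 * A ^ 3 * ‖c‖ ^ 6) := by simp
    _ ≤ 3 / τ * (64 * A ^ 3 * ‖c‖ ^ 6) := by gcongr
    _ = _ := by ring

end

/-- Each level `2^i γ ≤ g < 2^(i+1) γ` contributes at most `64 D` by the weak bound, and `hsup`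
leaves only `n + 1` levels. This replaces the strong-type Hardy–Littlewood–Sobolev inequality at a
logarithmic cost. -/
lemma lintegral_pow_six_le {μ : Measure ℝ} [IsProbabilityMeasure μ] {g : ℝ → ℝ} (hg : Measurable g)
    (hg0 : ∀ t, 0 ≤ g t) {γ D : ℝ} {n : ℕ} (hγ : 0 ≤ γ) (hD : 0 ≤ D)
    (hsup : ∀ t, g t ≤ 2 ^ n * γ)
    (hweak : ∀ lam, 0 < lam → lam ^ 6 * μ.real {t | lam ≤ g t} ≤ D) :
    ∫⁻ t, ENNReal.ofReal (g t ^ 6) ∂μ ≤ ENNReal.ofReal (γ ^ 6 + 64 * (n + 1) * D) := by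
  rcases hγ.eq_or_lt with rfl | hγ
  · have : ∀ t, g t = 0 := fun t => le_antisymm (by simpa using hsup t) (hg0 t)
    simp [this]
  have hS : ∀ i : ℕ, MeasurableSet {t | 2 ^ i * γ ≤ g t} := fun i =>
    measurableSet_le measurable_const hg
  have hpt : ∀ t, ENNReal.ofReal (g t ^ 6) ≤ ENNReal.ofReal (γ ^ 6) +
      ∑ i ∈ Finset.range (n + 1), {t | 2 ^ i * γ ≤ g t}.indicator
        (fun _ => ENNReal.ofReal (64 * (2 ^ i * γ) ^ 6)) t := fun t => by
    rcases le_or_gt (g t) γ with h | h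
    · refine le_add_right (ENNReal.ofReal_le_ofReal ?_)
      have := hg0 t
      gcongr
    · obtain ⟨i, hi1, hi2⟩ := exists_nat_pow_near (x := g t / γ) (y := 2)
        ((one_le_div hγ).2 h.le) (by norm_num)
      rw [le_div_iff₀ hγ] at hi1
      rw [div_lt_iff₀ hγ] at hi2
      have hin : i ≤ n := by
        by_contra! hcon
        have h1 : (2:ℝ) ^ n * γ < 2 ^ i * γ := by
          gcongr
          norm_num
        linarith [hsup t]
      refine le_add_left (le_trans ?_ (Finset.single_le_sum (fun _ _ => zero_le)
        (Finset.mem_range.2 (Nat.lt_succ_of_le hin))))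
      rw [Set.indicator_of_mem (show t ∈ {t | 2 ^ i * γ ≤ g t} from hi1)]
      refine ENNReal.ofReal_le_ofReal ?_
      calc g t ^ 6 ≤ (2 ^ (i + 1) * γ) ^ 6 := by
            have := hg0 t
            gcongr
        _ = 64 * (2 ^ i * γ) ^ 6 := by ring
  calc _ ≤ ∫⁻ t, (ENNReal.ofReal (γ ^ 6) + ∑ i ∈ Finset.range (n + 1),
        {t | 2 ^ i * γ ≤ g t}.indicator (fun _ => ENNReal.ofReal (64 * (2 ^ i * γ) ^ 6)) t) ∂μ :=
        lintegral_mono hpt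
    _ = ENNReal.ofReal (γ ^ 6) + ∑ i ∈ Finset.range (n + 1),
        ENNReal.ofReal (64 * (2 ^ i * γ) ^ 6) * μ {t | 2 ^ i * γ ≤ g t} := by
        rw [lintegral_add_left measurable_const, lintegral_finsetSum]
        · simp [lintegral_indicator (hS _)]
        · exact fun i _ => measurable_const.indicator (hS i)
    _ ≤ ENNReal.ofReal (γ ^ 6) + ∑ i ∈ Finset.range (n + 1), ENNReal.ofReal (64 * D) := by
        gcongr with i _
        rw [← ENNReal.ofReal_toReal (measure_ne_top μ {t | 2 ^ i * γ ≤ g t}),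
          ← ENNReal.ofReal_mul (by positivity)]
        refine ENNReal.ofReal_le_ofReal ?_
        have := hweak (2 ^ i * γ) (by positivity)
        rw [Measure.real] at this
        linarith
    _ = _ := by
        rw [Finset.sum_const, Finset.card_range, ← ENNReal.ofReal_nsmul,
          ← ENNReal.ofReal_add (by positivity) (by positivity)]
        congr 1
        simp
        ring

/-! ### Fourier analysis on the lattice -/

section

variable {M : ℕ}

lemma mesh_pos (hM : 1 ≤ M) : 0 < mesh M := by
  have : (0 : ℝ) < M := by exact_mod_cast hM
  exact div_pos Real.pi_pos this

lemma mesh_mul (hM : 1 ≤ M) : mesh M * M = Real.pi := by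
  have : (0 : ℝ) < M := by exact_mod_cast hM
  unfold mesh
  field_simp

lemma lintegral_latticeMeasure (f : Idx M → ℝ≥0∞) :
    ∫⁻ j, f j ∂latticeMeasure M = ENNReal.ofReal (mesh M) * ∑ j, f j := by
  rw [latticeMeasure, lintegral_smul_measure, lintegral_count, tsum_fintype, smul_eq_mul]

lemma sum_idx_eq_sum_range {β : Type*} [AddCommMonoid β] (f : ℤ → β) :
    ∑ j : Idx M, f j.1 = ∑ i ∈ Finset.range (2 * M), f (i - M) := by
  rw [Finset.sum_coe_sort (Finset.Ico (-(M : ℤ)) M) f]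
  symm
  refine Finset.sum_bij (fun (i : ℕ) _ => (i : ℤ) - M) (fun i hi => ?_) (fun i _ i' _ h => ?_)
    (fun k hk => ?_) fun i _ => rfl
  · rw [Finset.mem_range] at hi
    rw [Finset.mem_Ico]
    omega
  · omega
  · rw [Finset.mem_Ico] at hk
    exact ⟨(k + M).toNat, Finset.mem_range.2 (by omega), by omega⟩

/-- Orthogonality of the characters of the lattice. -/
lemma sum_character (hM : 1 ≤ M) (m : ℤ) (hm : m ≠ 0) (hm' : |m| < 2 * M) :
    ∑ j : Idx M, Complex.exp (Complex.I * ((pt j * m : ℝ) : ℂ)) = 0 := by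
  have hM0 : (M : ℂ) ≠ 0 := by exact_mod_cast (by omega : M ≠ 0)
  have hpi : (Real.pi : ℂ) ≠ 0 := by exact_mod_cast Real.pi_ne_zero
  set w := Complex.exp (Complex.I * ((mesh M * m : ℝ) : ℂ)) with hw
  have h1 : w ≠ 1 := fun h => by
    obtain ⟨n, hn⟩ := Complex.exp_eq_one_iff.1 h
    have h2 : (m : ℂ) = 2 * M * n := by
      simp only [mesh] at hn
      push_cast at hn
      field_simp at hn
      linear_combination hn
    have h3 : m = 2 * M * n := by exact_mod_cast h2
    have hn0 : n ≠ 0 := fun h0 => hm (by rw [h3, h0, mul_zero])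
    have : 1 ≤ |n| := Int.one_le_abs hn0
    rw [h3, abs_mul, abs_of_nonneg (by positivity)] at hm'
    nlinarith [(by positivity : (0:ℤ) ≤ 2 * M)]
  have h2 : w ^ (2 * M) = 1 := by
    rw [hw, ← Complex.exp_nat_mul, Complex.exp_eq_one_iff]
    refine ⟨m, ?_⟩
    simp only [mesh]
    push_cast
    field_simp
  refine (sum_idx_eq_sum_range
    (fun i : ℤ => Complex.exp (Complex.I * ((mesh M * (i : ℝ) * m : ℝ) : ℂ)))).trans ?_
  have h3 : ∀ i : ℕ, Complex.exp (Complex.I * ((mesh M * (((i : ℤ) - M : ℤ) : ℝ) * m : ℝ) : ℂ)) =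
      Complex.exp (Complex.I * ((-mesh M * M * m : ℝ) : ℂ)) * w ^ i := fun i => by
    rw [hw, ← Complex.exp_nat_mul, ← Complex.exp_add]
    congr 1
    push_cast
    ring
  simp only [h3]
  rw [← Finset.mul_sum, geom_sum_eq h1, h2]
  simp

/-- Plancherel on the lattice. -/
lemma sum_norm_sq_trig (hM : 1 ≤ M) (S : Finset (Idx M)) (a : Idx M → ℂ) :
    mesh M * ∑ j : Idx M, ‖∑ k ∈ S, a k * Complex.exp (Complex.I * ((pt j * k.1 : ℝ) : ℂ))‖ ^ 2 =
      2 * Real.pi * ∑ k ∈ S, ‖a k‖ ^ 2 := by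
  -- Two frequencies differ by less than `2M`, so there is no aliasing and only the diagonal
  -- survives.
  have key : ∀ k l : Idx M, ∑ j : Idx M, Complex.exp (Complex.I * ((pt j * k.1 : ℝ) : ℂ)) *
      starRingEnd ℂ (Complex.exp (Complex.I * ((pt j * l.1 : ℝ) : ℂ))) =
      if k = l then (2 * M : ℂ) else 0 := fun k l => by
    have e : ∀ j : Idx M, Complex.exp (Complex.I * ((pt j * k.1 : ℝ) : ℂ)) *
        starRingEnd ℂ (Complex.exp (Complex.I * ((pt j * l.1 : ℝ) : ℂ))) =
        Complex.exp (Complex.I * ((pt j * ((k.1 - l.1 : ℤ) : ℝ) : ℝ) : ℂ)) := fun j => by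
      rw [← Complex.exp_conj, ← Complex.exp_add]
      congr 1
      simp
      ring
    simp only [e]
    split_ifs with h
    · have hcard : (Finset.univ : Finset (Idx M)).card = 2 * M := by
        rw [Finset.card_univ, Fintype.card_coe, Int.card_Ico]
        omega
      simp only [h, sub_self, Int.cast_zero, mul_zero, Complex.ofReal_zero, Complex.exp_zero,
        Finset.sum_const, hcard]
      simp
    · have hk := Finset.mem_Ico.1 k.2
      have hl := Finset.mem_Ico.1 l.2
      exact sum_character hM _ (sub_ne_zero.2 fun h' => h (Subtype.ext h'))
        (abs_lt.2 ⟨by omega, by omega⟩)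
  have h2 : (∑ j : Idx M,
      ‖∑ k ∈ S, a k * Complex.exp (Complex.I * ((pt j * k.1 : ℝ) : ℂ))‖ ^ 2 : ℝ) =
      2 * M * ∑ k ∈ S, ‖a k‖ ^ 2 := by
    apply Complex.ofReal_injective
    simp only [Complex.ofReal_sum, Complex.ofReal_pow, Complex.ofReal_mul (2 * (M : ℝ)),
      Complex.ofReal_mul (2 : ℝ), Complex.ofReal_ofNat, Complex.ofReal_natCast,
      ← Complex.mul_conj', map_sum, map_mul, Finset.sum_mul_sum]
    rw [Finset.sum_comm, Finset.mul_sum]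
    refine Finset.sum_congr rfl fun k hk => ?_
    rw [Finset.sum_comm]
    have : ∀ l ∈ S, ∑ j : Idx M, a k * Complex.exp (Complex.I * ((pt j * k.1 : ℝ) : ℂ)) *
        (starRingEnd ℂ (a l) * starRingEnd ℂ (Complex.exp (Complex.I * ((pt j * l.1 : ℝ) : ℂ)))) =
        a k * starRingEnd ℂ (a l) * if k = l then (2 * M : ℂ) else 0 := fun l _ => by
      rw [← key, Finset.mul_sum]
      exact Finset.sum_congr rfl fun j _ => by ring
    rw [Finset.sum_congr rfl this]
    simp only [mul_ite, mul_zero, Finset.sum_ite_eq, hk, if_true]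
    ring
  rw [h2, ← mul_assoc]
  congr 1
  linear_combination 2 * mesh_mul hM

/-- Interpolation of the lattice norms between `L^2_h` and `L^∞_h`. -/
lemma latticeNorm_le_interpolation {r : ℝ≥0∞} (hr : 2 ≤ r) (hM : 1 ≤ M) {f : Idx M → ℂ} {A : ℝ}
    (hA : 0 ≤ A) (h2 : mesh M * ∑ j, ‖f j‖ ^ 2 ≤ A ^ 2) :
    latticeNorm r f ≤ ENNReal.ofReal (A ^ (2 / r.toReal) * ‖f‖ ^ (1 - 2 / r.toReal)) := by
  unfold latticeNorm
  rcases eq_or_ne r ⊤ with rfl | hr'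
  -- For `r = ∞`, `toReal` is `0` and `2 / 0 = 0`, which is the correct exponent.
  · simp only [ENNReal.toReal_top, div_zero, Real.rpow_zero, one_mul, sub_zero, Real.rpow_one,
      eLpNorm_exponent_top]
    exact eLpNormEssSup_le_of_ae_bound (ae_of_all _ fun j => norm_le_pi_norm f j)
  have hr2 : 2 ≤ r.toReal := by
    simpa using (ENNReal.toReal_le_toReal (by simp) hr').2 hr
  have hr0 : 0 < r.toReal := by linarith
  rw [eLpNorm_eq_lintegral_rpow_enorm_toReal (by positivity) hr', lintegral_latticeMeasure]
  have hmesh := mesh_pos hM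
  have hB : 0 ≤ ‖f‖ := norm_nonneg _
  have e : ENNReal.ofReal (mesh M) * ∑ j, ‖f j‖ₑ ^ r.toReal =
      ENNReal.ofReal (mesh M * ∑ j, ‖f j‖ ^ r.toReal) := by
    rw [ENNReal.ofReal_mul hmesh.le, ENNReal.ofReal_sum_of_nonneg (fun j _ => by positivity)]
    congr 1
    refine Finset.sum_congr rfl fun j _ => ?_
    rw [← ofReal_norm, ENNReal.ofReal_rpow_of_nonneg (norm_nonneg _) hr0.le]
  rw [e, ENNReal.ofReal_rpow_of_nonneg (by positivity) (by positivity)]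
  refine ENNReal.ofReal_le_ofReal ?_
  have h3 : mesh M * ∑ j, ‖f j‖ ^ r.toReal ≤ A ^ 2 * ‖f‖ ^ (r.toReal - 2) := by
    calc mesh M * ∑ j, ‖f j‖ ^ r.toReal ≤ mesh M * ∑ j, ‖f j‖ ^ 2 * ‖f‖ ^ (r.toReal - 2) := by
          gcongr with j _
          rw [show ‖f j‖ ^ r.toReal = ‖f j‖ ^ 2 * ‖f j‖ ^ (r.toReal - 2) by
            rw [← Real.rpow_two, ← Real.rpow_add' (norm_nonneg _) (by linarith)]
            congr 1
            ring]
          gcongr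
          exact norm_le_pi_norm f j
      _ = (mesh M * ∑ j, ‖f j‖ ^ 2) * ‖f‖ ^ (r.toReal - 2) := by
          rw [← Finset.sum_mul, mul_assoc]
      _ ≤ _ := by gcongr
  calc (mesh M * ∑ j, ‖f j‖ ^ r.toReal) ^ (1 / r.toReal)
      ≤ (A ^ 2 * ‖f‖ ^ (r.toReal - 2)) ^ (1 / r.toReal) := by gcongr
    _ = _ := by
        rw [Real.mul_rpow (by positivity) (by positivity), ← Real.rpow_two, ← Real.rpow_mul hA,
          ← Real.rpow_mul hB]
        congr 2
        · ring
        · field_simp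

/-- The Schrödinger evolution of the frequencies in `S`. -/
noncomputable def evolution (S : Finset (Idx M)) (α : ℝ) (c : Idx M → ℂ) (t : ℝ) (j : Idx M) : ℂ :=
  ∑ k ∈ S, c k * Complex.exp (Complex.I * ((pt j * k.1 - t * symbol M α k.1 : ℝ) : ℂ))

/-- The `ℓ²` mass of the coefficients in `S`. -/
noncomputable def mass (S : Finset (Idx M)) (c : Idx M → ℂ) : ℝ := Real.sqrt (∑ k ∈ S, ‖c k‖ ^ 2)

/-- The time factors are unimodular; `3` rounds up `√(2π)`. -/
lemma evolution_plancherel (hM : 1 ≤ M) (S : Finset (Idx M)) (α : ℝ) (c : Idx M → ℂ) (t : ℝ) :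
    mesh M * ∑ j, ‖evolution S α c t j‖ ^ 2 ≤ (3 * mass S c) ^ 2 := by
  have e : ∀ j, evolution S α c t j = ∑ k ∈ S,
      (c k * Complex.exp (Complex.I * ((-t * symbol M α k.1 : ℝ) : ℂ))) *
        Complex.exp (Complex.I * ((pt j * k.1 : ℝ) : ℂ)) := fun j => by
    refine Finset.sum_congr rfl fun k _ => ?_
    rw [mul_assoc, ← Complex.exp_add]
    congr 2
    push_cast
    ring
  simp only [e]
  rw [sum_norm_sq_trig hM, mul_pow, mass, Real.sq_sqrt (Finset.sum_nonneg fun _ _ => by positivity)]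
  have h1 : ∀ k : Idx M, ‖c k * Complex.exp (Complex.I * ((-t * symbol M α k.1 : ℝ) : ℂ))‖ = ‖c k‖ :=
    fun k => by rw [norm_mul, mul_comm Complex.I, Complex.norm_exp_ofReal_mul_I, mul_one]
  simp only [h1]
  gcongr
  linarith [Real.pi_lt_d2]

end

/-! ### Strichartz estimates on dyadic blocks -/

section

variable {M : ℕ}

/-- The dyadic blocks of frequencies: the origin, and `2^n ≤ ± k < 2^(n + 1)`. -/
noncomputable def block (M : ℕ) : Option (ℕ × Bool) → Finset (Idx M)
  | none => Finset.univ.filter fun k => k.1 = 0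
  | some (n, true) => Finset.univ.filter fun k => 2 ^ n ≤ k.1 ∧ k.1 < 2 ^ (n + 1)
  | some (n, false) => Finset.univ.filter fun k => 2 ^ n ≤ -k.1 ∧ -k.1 < 2 ^ (n + 1)

/-- The dyadic exponent of a block. -/
def level : Option (ℕ × Bool) → ℕ
  | none => 0
  | some (n, _) => n

/-- The symbol is even and `h|k|/2 ≤ π/2`, so the absolute value can be dropped. -/
lemma symbol_eq_chord (hM : 1 ≤ M) (α : ℝ) {k : ℤ} (hk : |k| ≤ M) :
    symbol M α k = chord (mesh M) (k.natAbs : ℝ) ^ α := by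
  have hm := mesh_pos hM
  have h1 : ((k.natAbs : ℕ) : ℝ) = |(k : ℝ)| := by
    rw [← Int.cast_abs, ← Int.natCast_natAbs]; simp
  have h2 : |(k : ℝ)| ≤ M := by exact_mod_cast hk
  have h3 : |2 / mesh M * Real.sin (mesh M * k / 2)| = |chord (mesh M) (|(k : ℝ)|)| := by
    unfold chord
    rcases abs_choice (k : ℝ) with h | h
    · rw [h]
    · rw [h, mul_neg, neg_div, Real.sin_neg, mul_neg, abs_neg]
  unfold symbol
  rw [h3, h1, abs_of_nonneg]
  have h4 : mesh M * |(k : ℝ)| ≤ Real.pi := by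
    rw [← mesh_mul hM]; gcongr
  have h5 : 0 ≤ mesh M * |(k : ℝ)| := by positivity
  exact mul_nonneg (by positivity) (Real.sin_nonneg_of_nonneg_of_le_pi (by linarith) (by linarith))

/-- A sum over a dyadic block is a sum over an interval of natural numbers. -/
lemma exists_block_eq_Ico (hM : 1 ≤ M) (n : ℕ) (b : Bool) : ∃ L : ℕ, L ≤ 2 * 2 ^ n ∧ L ≤ M + 1 ∧
    ∃ e : ℤ, |e| = 1 ∧ (∀ k ∈ block M (some (n, b)), k.1 = e * k.1.natAbs) ∧
    ∀ {β : Type} [AddCommMonoid β] (f : ℕ → β),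
      ∑ k ∈ block M (some (n, b)), f k.1.natAbs = ∑ k ∈ Finset.Ico (2 ^ n) L, f k := by
  have hpow : (2 : ℕ) ^ (n + 1) = 2 * 2 ^ n := pow_succ' 2 n
  have hn : (1 : ℕ) ≤ 2 ^ n := Nat.one_le_two_pow
  have hc : ((2 : ℤ) ^ n) = ((2 ^ n : ℕ) : ℤ) := by push_cast; rfl
  have hc' : ((2 : ℤ) ^ (n + 1)) = ((2 ^ (n + 1) : ℕ) : ℤ) := by push_cast; rfl
  rcases b with _ | _
  -- The frequency `-M` belongs to the dual lattice and `M` does not, so the negative blocks reach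
  -- one step further.
  · refine ⟨min (2 * 2 ^ n) (M + 1), min_le_left _ _, min_le_right _ _, -1, by simp, ?_, ?_⟩
    · intro k hk
      simp only [block, Finset.mem_filter, hc, hc', hpow] at hk
      omega
    · intro β _ f
      refine Finset.sum_bij (fun k _ => k.1.natAbs) (fun k hk => ?_) (fun k hk l hl h => ?_)
        (fun m hm => ?_) fun k _ => rfl
      · have := Finset.mem_Ico.1 k.2
        simp only [block, Finset.mem_filter, hc, hc', hpow] at hk
        rw [Finset.mem_Ico]
        omega
      · simp only [block, Finset.mem_filter, hc, hc', hpow] at hk hl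
        exact Subtype.ext (by omega)
      · rw [Finset.mem_Ico] at hm
        refine ⟨⟨-m, Finset.mem_Ico.2 ⟨by omega, by omega⟩⟩, ?_, by simp⟩
        simp only [block, Finset.mem_filter, hc, hc', hpow, Finset.mem_univ, true_and]
        omega
  · refine ⟨min (2 * 2 ^ n) M, min_le_left _ _, (min_le_right _ _).trans (by omega), 1, by simp, ?_,
      ?_⟩
    · intro k hk
      simp only [block, Finset.mem_filter, hc, hc', hpow] at hk
      omega
    · intro β _ f
      refine Finset.sum_bij (fun k _ => k.1.natAbs) (fun k hk => ?_) (fun k hk l hl h => ?_)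
        (fun m hm => ?_) fun k _ => rfl
      · have := Finset.mem_Ico.1 k.2
        simp only [block, Finset.mem_filter, hc, hc', hpow] at hk
        rw [Finset.mem_Ico]
        omega
      · simp only [block, Finset.mem_filter, hc, hc', hpow] at hk hl
        exact Subtype.ext (by omega)
      · rw [Finset.mem_Ico] at hm
        refine ⟨⟨m, Finset.mem_Ico.2 ⟨by omega, by omega⟩⟩, ?_, by simp⟩
        simp only [block, Finset.mem_filter, hc, hc', hpow, Finset.mem_univ, true_and]
        omega

lemma card_block_le (hM : 1 ≤ M) (n : ℕ) (b : Bool) : (block M (some (n, b))).card ≤ 2 ^ n := by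
  obtain ⟨L, h1, -, -, -, -, h⟩ := exists_block_eq_Ico hM n b
  have := h (fun _ => 1)
  simp only [Finset.sum_const, smul_eq_mul, mul_one, Nat.card_Ico] at this
  omega

/-- The sign of the block is moved into `x`; the symbol is even. -/
lemma block_kernel (hM : 1 ≤ M) {α : ℝ} (hα : 1 < α) (hα2 : α ≤ 2) (n : ℕ) (b : Bool) {t : ℝ}
    (ht : t ≠ 0) (ht' : |t| * (4 * ((2 : ℝ) ^ n) ^ (α - 1)) ≤ 1) (x : ℝ) :
    ‖∑ k ∈ block M (some (n, b)),
        Complex.exp (Complex.I * ((x * k.1 - t * symbol M α k.1 : ℝ) : ℂ))‖ ≤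
      200 * ((α - 1) * ((2 : ℝ) ^ n) ^ (α - 3)) ^ (-(1 / 3) : ℝ) * |t| ^ (-(1 / 3) : ℝ) := by
  obtain ⟨L, h1, h2, e, -, he, h⟩ := exists_block_eq_Ico hM n b
  have hcast : (((2 ^ n : ℕ) : ℕ) : ℝ) = (2 : ℝ) ^ n := by push_cast; rfl
  have := dispersive_estimate (h := mesh M) (α := α) (N := 2 ^ n) (L := L) (mesh_pos hM) hα hα2
    Nat.one_le_two_pow h1 (fun k hk => by
      rw [← mesh_mul hM]
      have := mesh_pos hM
      gcongr
      have := (Finset.mem_Ico.1 hk).2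
      exact_mod_cast (by omega : k ≤ M)) t (x * e) ht (by rwa [hcast])
  rw [hcast, ← h (fun k => Complex.exp
    (Complex.I * ((x * e * k - t * chord (mesh M) k ^ α : ℝ) : ℂ)))] at this
  refine le_trans (le_of_eq ?_) this
  congr 1
  refine Finset.sum_congr rfl fun k hk => ?_
  have hk2 := Finset.mem_Ico.1 k.2
  rw [symbol_eq_chord hM α (abs_le.2 ⟨by omega, by omega⟩)]
  congr 3
  have : (k.1 : ℝ) = e * (k.1.natAbs : ℝ) := by
    rw [← Int.cast_natCast (k.1.natAbs), ← Int.cast_mul, ← he k hk]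
  rw [this, mul_assoc]

/-- The vector of `ℓ²(S)` representing the evolution at a space-time point. -/
noncomputable def wave (S : Finset (Idx M)) (α t : ℝ) (j : Idx M) : EuclideanSpace ℂ (Idx M) :=
  WithLp.toLp 2 fun k => if k ∈ S then
    Complex.exp (-(Complex.I * ((pt j * k.1 - t * symbol M α k.1 : ℝ) : ℂ))) else 0

lemma inner_wave (S : Finset (Idx M)) (α t : ℝ) (j : Idx M) (c : Idx M → ℂ) :
    inner ℂ (wave S α t j) (WithLp.toLp 2 fun k => if k ∈ S then c k else 0) =
      evolution S α c t j := by
  rw [PiLp.inner_apply, evolution]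
  simp only [wave, RCLike.inner_apply, apply_ite (starRingEnd ℂ), map_zero, ite_mul, mul_ite,
    zero_mul, mul_zero]
  rw [← Finset.sum_filter, Finset.filter_mem_eq_inter, Finset.univ_inter]
  refine Finset.sum_congr rfl fun k hk => ?_
  rw [if_pos hk, ← Complex.exp_conj]
  simp

lemma norm_toLp_indicator (S : Finset (Idx M)) (c : Idx M → ℂ) :
    ‖(WithLp.toLp 2 fun k => if k ∈ S then c k else 0 : EuclideanSpace ℂ (Idx M))‖ = mass S c := by
  rw [EuclideanSpace.norm_eq, mass]
  congr 1
  simp only [apply_ite (fun z : ℂ => ‖z‖ ^ 2)]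
  rw [← Finset.sum_filter_add_sum_filter_not Finset.univ (fun k => k ∈ S)]
  rw [Finset.sum_congr rfl fun k hk => if_pos (Finset.mem_filter.1 hk).2,
    Finset.sum_congr rfl fun k hk => if_neg (Finset.mem_filter.1 hk).2,
    Finset.filter_mem_eq_inter, Finset.univ_inter]
  simp

lemma mass_nonneg (S : Finset (Idx M)) (c : Idx M → ℂ) : 0 ≤ mass S c := Real.sqrt_nonneg _

lemma norm_wave (S : Finset (Idx M)) (α t : ℝ) (j : Idx M) :
    ‖wave S α t j‖ = Real.sqrt S.card := by
  rw [wave, norm_toLp_indicator, mass]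
  congr 1
  have : ∀ k : Idx M, ‖Complex.exp (-(Complex.I * ((pt j * k.1 - t * symbol M α k.1 : ℝ) : ℂ)))‖ = 1 :=
    fun k => by
      rw [← mul_neg, ← Complex.ofReal_neg, mul_comm, Complex.norm_exp_ofReal_mul_I]
  simp only [this]
  simp

lemma inner_wave_wave (S : Finset (Idx M)) (α t s : ℝ) (i j : Idx M) :
    inner ℂ (wave S α t i) (wave S α s j) = ∑ k ∈ S, Complex.exp
      (Complex.I * (((pt i - pt j) * k.1 - (t - s) * symbol M α k.1 : ℝ) : ℂ)) := by
  conv_lhs => rw [wave.eq_1 S α s j]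
  rw [inner_wave, evolution]
  refine Finset.sum_congr rfl fun k _ => ?_
  rw [← Complex.exp_add]
  congr 1
  push_cast
  ring

lemma continuous_evolution (S : Finset (Idx M)) (α : ℝ) (c : Idx M → ℂ) :
    Continuous (evolution S α c) := by
  unfold evolution
  fun_prop

lemma continuous_wave (S : Finset (Idx M)) (α : ℝ) (j : Idx M) :
    Continuous fun t => wave S α t j := by
  unfold wave
  refine (PiLp.continuous_toLp 2 _).comp (continuous_pi fun k => ?_)
  split_ifs
  · fun_prop
  · exact continuous_const

instance : IsProbabilityMeasure timeMeasure := ⟨by simp [timeMeasure]⟩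

/-- The sixth power of the `L^6_t L^∞_x` norm of a block. -/
lemma lintegral_block (hM : 1 ≤ M) {α : ℝ} (hα : 1 < α) (hα2 : α ≤ 2) (b : Option (ℕ × Bool))
    (c : Idx M → ℂ) :
    ∫⁻ t, ENNReal.ofReal (‖evolution (block M b) α c t‖ ^ 6) ∂timeMeasure ≤
      ENNReal.ofReal (10 ^ 12 * (level b + 1) * 4 ^ level b / (α - 1) * mass (block M b) c ^ 6) := by
  have ha : 0 < α - 1 := by linarith
  have ha1 : 1 ≤ 1 / (α - 1) := by rw [le_div_iff₀ ha]; linarith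
  set S := block M b with hS
  set cS : EuclideanSpace ℂ (Idx M) := WithLp.toLp 2 fun k => if k ∈ S then c k else 0 with hcS
  -- Cauchy–Schwarz over the frequencies of the block.
  have hsup : ∀ R, S.card ≤ R ^ 2 → ∀ t, ‖evolution S α c t‖ ≤ R * mass S c := fun R hR t => by
    refine (pi_norm_le_iff_of_nonneg (mul_nonneg R.cast_nonneg (mass_nonneg _ _))).2 fun j => ?_
    rw [← inner_wave]
    refine (norm_inner_le_norm _ _).trans ?_
    rw [norm_wave, norm_toLp_indicator]
    refine mul_le_mul_of_nonneg_right ?_ (mass_nonneg _ _)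
    exact Real.sqrt_le_iff.2 ⟨R.cast_nonneg, by exact_mod_cast hR⟩
  rcases b with _ | ⟨n, b⟩
  · have hcard : S.card ≤ 1 ^ 2 := by
      rw [one_pow, Finset.card_le_one]
      intro k hk l hl
      simp only [hS, block, Finset.mem_filter] at hk hl
      exact Subtype.ext (by rw [hk.2, hl.2])
    calc _ ≤ ∫⁻ t, ENNReal.ofReal (mass S c ^ 6) ∂timeMeasure := by
          refine lintegral_mono fun t => ENNReal.ofReal_le_ofReal ?_
          have := hsup 1 hcard t
          simp only [Nat.cast_one, one_mul] at this
          gcongr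
      _ = ENNReal.ofReal (1 * mass S c ^ 6) := by simp
      _ ≤ _ := by
          refine ENNReal.ofReal_le_ofReal
            (mul_le_mul_of_nonneg_right ?_ (pow_nonneg (mass_nonneg _ _) _))
          rw [show (10:ℝ) ^ 12 * ((level none : ℕ) + 1) * 4 ^ level none / (α - 1) =
            10 ^ 12 * (1 / (α - 1)) by simp [level]; ring]
          linarith
  -- Wasteful but harmless: the sup bound only fixes the number of levels, `n + 1`.
  · have hcard : S.card ≤ (2 ^ n) ^ 2 := (card_block_le hM n b).trans (Nat.le_self_pow two_ne_zero _)
    set N : ℝ := 2 ^ n with hN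
    have hN1 : 1 ≤ N := one_le_pow₀ (by norm_num)
    have hN0 : 0 < N := by linarith
    set A : ℝ := 200 * ((α - 1) * N ^ (α - 3)) ^ (-(1 / 3) : ℝ) with hA
    -- The longest time gap that `block_kernel` admits.
    set τ : ℝ := 1 / (4 * N ^ (α - 1)) with hτ
    have hNα : 1 ≤ N ^ (α - 1) := Real.one_le_rpow hN1 ha.le
    have hτ0 : 0 < τ := by positivity
    have hτ1 : τ ≤ 1 := by rw [hτ, div_le_one (by positivity)]; linarith
    set D : ℝ := 192 / τ * A ^ 3 * mass S c ^ 6 with hD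
    have hweak : ∀ lam, 0 < lam →
        lam ^ 6 * timeMeasure.real {t | lam ≤ ‖evolution S α c t‖} ≤ D := fun lam hlam => by
      have := large_values (wave S α) (continuous_wave S α) (R := Real.sqrt S.card)
        (fun t j => (norm_wave S α t j).le) (A := A) (τ := τ) (by positivity) hlam hτ0 hτ1
        (fun t s hts hle i j => by
          rw [inner_wave_wave]
          exact block_kernel hM hα hα2 n b (sub_ne_zero.2 hts)
            (by rwa [hτ, le_div_iff₀ (by positivity)] at hle) _) cS
      rw [norm_toLp_indicator] at this
      refine le_trans (le_of_eq ?_) this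
      rw [timeMeasure, measureReal_restrict_apply (measurableSet_le measurable_const
        (continuous_evolution S α c).norm.measurable)]
      congr 3
      ext t
      simp only [Set.mem_ofPred_eq, hcS, inner_wave]
      have := pi_norm_lt_iff (x := evolution S α c t) hlam
      constructor
      · intro h
        by_contra! hcon
        exact absurd (this.2 hcon) (not_lt.2 h)
      · rintro ⟨j, hj⟩
        exact hj.trans (norm_le_pi_norm _ j)
    -- `1/τ` contributes `N^(α-1)` and `A^3` contributes `N^(3-α)/(α - 1)`, so `α` leaves the
    -- exponent of `N`. The number is `192 · 4 · 200³`.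
    have hDe : D = 6144000000 * (N ^ 2 / (α - 1)) * mass S c ^ 6 := by
      have hA3 : A ^ 3 = 8000000 / ((α - 1) * N ^ (α - 3)) := by
        rw [hA, mul_pow, ← Real.rpow_natCast (_ ^ (-(1 / 3) : ℝ)), ← Real.rpow_mul (by positivity)]
        norm_num
        rw [Real.rpow_neg_one, div_eq_mul_inv]
      have hNN : N ^ (α - 1) = N ^ (α - 3) * N ^ 2 := by
        rw [← Real.rpow_two, ← Real.rpow_add hN0]; congr 1; ring
      rw [hD, hA3, hτ, hNN]
      field_simp
      ring
    have := lintegral_pow_six_le (μ := timeMeasure) (g := fun t => ‖evolution S α c t‖)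
      (continuous_evolution S α c).norm.measurable (fun t => norm_nonneg _) (γ := mass S c) (D := D)
      (n := n) (mass_nonneg _ _) (by rw [hDe]; have := mass_nonneg S c; positivity)
      (fun t => by simpa [hN] using hsup (2 ^ n) hcard t) hweak
    refine this.trans (ENNReal.ofReal_le_ofReal ?_)
    have h4 : (4 : ℝ) ^ n = N ^ 2 := by rw [hN, ← pow_mul, mul_comm, pow_mul]; norm_num
    simp only [level]
    rw [hDe, h4]
    have hX : 1 ≤ N ^ 2 * (1 / (α - 1)) := one_le_mul_of_one_le_of_one_le (one_le_pow₀ hN1) ha1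
    have hm := pow_nonneg (mass_nonneg S c) 6
    have hY : 1 ≤ ((n : ℝ) + 1) * (N ^ 2 * (1 / (α - 1))) :=
      one_le_mul_of_one_le_of_one_le (by linarith [(Nat.cast_nonneg n : (0:ℝ) ≤ n)]) hX
    calc _ = (1 + 64 * 6144000000 * (((n : ℝ) + 1) * (N ^ 2 * (1 / (α - 1))))) * mass S c ^ 6 := by
          ring
      _ ≤ (10 ^ 12 * (((n : ℝ) + 1) * (N ^ 2 * (1 / (α - 1))))) * mass S c ^ 6 := by
          refine mul_le_mul_of_nonneg_right ?_ hm
          linarith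
      _ = _ := by ring

end

/-! ### Summation over the dyadic blocks -/

section

variable {M : ℕ}

/-- The blocks that cover all frequencies. -/
def blocks (M : ℕ) : Finset (Option (ℕ × Bool)) :=
  Finset.insertNone (Finset.range (M + 1) ×ˢ Finset.univ)

/-- The blocks are the fibres of `k ↦ (log₂ |k|, sign k)`, with the origin apart. -/
lemma sum_blocks {β : Type*} [AddCommMonoid β] (f : Idx M → β) :
    ∑ b ∈ blocks M, ∑ k ∈ block M b, f k = ∑ k, f k := by
  classical
  set g : Idx M → Option (ℕ × Bool) := fun k =>
    if k.1 = 0 then none else some (Nat.log 2 k.1.natAbs, decide (0 < k.1)) with hg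
  have hmaps : ∀ k ∈ (Finset.univ : Finset (Idx M)), g k ∈ blocks M := fun k _ => by
    have hk := Finset.mem_Ico.1 k.2
    have := Nat.log_le_self 2 k.1.natAbs
    simp only [hg, blocks]
    split_ifs
    · exact Finset.none_mem_insertNone
    · rw [Finset.some_mem_insertNone, Finset.mem_product, Finset.mem_range]
      exact ⟨by dsimp only; omega, Finset.mem_univ _⟩
  rw [← Finset.sum_fiberwise_of_maps_to hmaps]
  refine Finset.sum_congr rfl fun b _ => Finset.sum_congr ?_ fun _ _ => rfl
  ext k
  rcases b with _ | ⟨n, b⟩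
  · simp [block, hg]
  have h1 : (2 : ℤ) ^ n = ((2 ^ n : ℕ) : ℤ) := by push_cast; rfl
  have h2 : (2 : ℤ) ^ (n + 1) = ((2 ^ (n + 1) : ℕ) : ℤ) := by push_cast; rfl
  have h3 : 0 < 2 ^ n := Nat.two_pow_pos n
  have hlog : k.1 ≠ 0 → (Nat.log 2 k.1.natAbs = n ↔
      2 ^ n ≤ k.1.natAbs ∧ k.1.natAbs < 2 ^ (n + 1)) := fun hk =>
    Nat.log_eq_iff (Or.inr ⟨one_lt_two, by omega⟩)
  by_cases hk : k.1 = 0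
  · cases b <;> simp only [block, hg, hk, Finset.mem_filter, Finset.mem_univ, true_and, if_true,
      h1, h2] <;>
      exact iff_of_false (fun h => by omega) (Option.some_ne_none _).symm
  cases b <;> simp only [block, hg, hk, Finset.mem_filter, Finset.mem_univ, true_and, if_false,
    Option.some.injEq, Prod.mk.injEq, hlog hk, decide_eq_true_eq, decide_eq_false_iff_not, h1, h2]
    <;> omega

lemma level_le_bracket (b : Option (ℕ × Bool)) {k : Idx M} (hk : k ∈ block M b) :
    (2 : ℝ) ^ level b ≤ bracket k.1 := by
  unfold bracket
  refine Real.le_sqrt_of_sq_le ?_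
  rw [sq_abs]
  rcases b with _ | ⟨n, b⟩
  · simp only [level]
    nlinarith [sq_nonneg (k.1 : ℝ)]
  have h0 : (0:ℝ) < 2 ^ n := by positivity
  have h : (2 : ℝ) ^ n ≤ k.1 ∨ (2 : ℝ) ^ n ≤ -k.1 := by
    cases b <;> simp only [block, Finset.mem_filter] at hk
    · exact Or.inr (by exact_mod_cast hk.2.1)
    · exact Or.inl (by exact_mod_cast hk.2.1)
  simp only [level]
  rcases h with h | h <;> nlinarith

/-- The Sobolev norm in terms of the Fourier coefficients. -/
noncomputable def coeffNorm (s : ℝ) (c : Idx M → ℂ) : ℝ :=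
  Real.sqrt ((2 * Real.pi)⁻¹ * ∑ k : Idx M, bracket (k.1 : ℝ) ^ (2 * s) * ‖c k‖ ^ 2)

lemma bracket_nonneg (ξ : ℝ) : 0 ≤ bracket ξ := Real.sqrt_nonneg _

/-- On the block `⟨k⟩ ≥ 2^level`, and `s ≥ 0`; the `3` covers `√(2π)`. -/
lemma mass_le_coeffNorm {s : ℝ} (hs : 0 ≤ s) (b : Option (ℕ × Bool)) (c : Idx M → ℂ) :
    ((2 : ℝ) ^ level b) ^ s * mass (block M b) c ≤ 3 * coeffNorm s c := by
  have hpi := Real.pi_pos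
  have h9 : (3 : ℝ) = Real.sqrt 9 := by
    rw [show (9 : ℝ) = 3 ^ 2 by norm_num, Real.sqrt_sq (by norm_num)]
  have hN : (0 : ℝ) ≤ ((2 : ℝ) ^ level b) ^ s := by positivity
  rw [coeffNorm, mass, h9, ← Real.sqrt_mul (by norm_num), ← Real.sqrt_sq hN,
    ← Real.sqrt_mul (by positivity)]
  refine Real.sqrt_le_sqrt ?_
  calc (((2 : ℝ) ^ level b) ^ s) ^ 2 * ∑ k ∈ block M b, ‖c k‖ ^ 2
      = ∑ k ∈ block M b, ((2 : ℝ) ^ level b) ^ (2 * s) * ‖c k‖ ^ 2 := by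
        rw [← Real.rpow_mul_natCast (by positivity), Finset.mul_sum, mul_comm s]
        norm_num
    _ ≤ ∑ k ∈ block M b, bracket (k.1 : ℝ) ^ (2 * s) * ‖c k‖ ^ 2 := by
        gcongr with k hk
        exact level_le_bracket b hk
    _ ≤ ∑ k : Idx M, bracket (k.1 : ℝ) ^ (2 * s) * ‖c k‖ ^ 2 :=
        Finset.sum_le_univ_sum_of_nonneg fun k =>
          mul_nonneg (Real.rpow_nonneg (bracket_nonneg _) _) (by positivity)
    _ ≤ (9 * (2 * Real.pi)⁻¹) * ∑ k : Idx M, bracket (k.1 : ℝ) ^ (2 * s) * ‖c k‖ ^ 2 := by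
        refine le_mul_of_one_le_left (Finset.sum_nonneg fun k _ =>
          mul_nonneg (Real.rpow_nonneg (bracket_nonneg _) _) (by positivity)) ?_
        rw [← div_eq_mul_inv, le_div_iff₀ (by positivity)]
        linarith [Real.pi_lt_d2]
    _ = _ := by ring

/-- The evolution with Fourier coefficients `c`. -/
noncomputable def flow (α : ℝ) (c : Idx M → ℂ) (t : ℝ) : Idx M → ℂ :=
  idft fun k => Complex.exp (-Complex.I * (t : ℂ) * (symbol M α (k.1 : ℝ) : ℂ)) * c k

lemma flow_eq_sum (α : ℝ) (c : Idx M → ℂ) (t : ℝ) :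
    flow α c t = (2 * (Real.pi : ℂ))⁻¹ • ∑ b ∈ blocks M, evolution (block M b) α c t := by
  ext j
  simp only [flow, idft, Pi.smul_apply, Finset.sum_apply, evolution, smul_eq_mul]
  rw [sum_blocks]
  congr 1
  refine Finset.sum_congr rfl fun k _ => ?_
  rw [mul_comm (Complex.exp _) (c k), mul_assoc, ← Complex.exp_add]
  congr 2
  push_cast
  ring

/-- The pointwise in time majorant of the `L^r_h` norm of the flow. -/
noncomputable def majorant (α θ : ℝ) (c : Idx M → ℂ) (t : ℝ) : ℝ :=
  3 * ∑ b ∈ blocks M, mass (block M b) c ^ (1 - θ) * ‖evolution (block M b) α c t‖ ^ θ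

lemma majorant_nonneg (α θ : ℝ) (c : Idx M → ℂ) (t : ℝ) : 0 ≤ majorant α θ c t :=
  mul_nonneg (by norm_num) (Finset.sum_nonneg fun _ _ =>
    mul_nonneg (Real.rpow_nonneg (mass_nonneg _ _) _) (Real.rpow_nonneg (norm_nonneg _) _))

/-- Triangle inequality over the blocks, then interpolation between the conserved `L²` mass and the
sup norm at the fixed time. -/
lemma latticeNorm_flow_le (hM : 1 ≤ M) {r : ℝ≥0∞} (hr : 2 ≤ r) {θ : ℝ}
    (hθ : θ = 1 - 2 / r.toReal) (hθ0 : 0 ≤ θ) (α : ℝ) (c : Idx M → ℂ) (t : ℝ) :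
    latticeNorm r (flow α c t) ≤ ENNReal.ofReal (majorant α θ c t) := by
  rw [flow_eq_sum]
  have hr1 : 1 ≤ r := le_trans (by norm_num) hr
  have hpi := Real.pi_gt_three
  have h1 : ‖(2 * (Real.pi : ℂ))⁻¹‖ₑ ≤ 1 := by
    rw [← ofReal_norm, ENNReal.ofReal_le_one, norm_inv, norm_mul, Complex.norm_real,
      Real.norm_of_nonneg (by linarith), Complex.norm_two]
    exact inv_le_one_of_one_le₀ (by linarith)
  refine (eLpNorm_const_smul_le (c := (2 * (Real.pi : ℂ))⁻¹) (p := r)).trans ?_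
  refine (mul_le_of_le_one_left zero_le h1).trans ?_
  refine (eLpNorm_sum_le (fun b _ => .of_discrete) hr1).trans ?_
  rw [majorant, Finset.mul_sum, ENNReal.ofReal_sum_of_nonneg fun b _ =>
    mul_nonneg (by norm_num) (mul_nonneg (Real.rpow_nonneg (mass_nonneg _ _) _)
      (Real.rpow_nonneg (norm_nonneg _) _))]
  refine Finset.sum_le_sum fun b _ => ?_
  have hm := mass_nonneg (block M b) c
  refine (latticeNorm_le_interpolation hr hM (by positivity)
    (evolution_plancherel hM (block M b) α c t)).trans (ENNReal.ofReal_le_ofReal ?_)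
  rw [← hθ, show 2 / r.toReal = 1 - θ by rw [hθ]; ring, Real.mul_rpow (by norm_num) hm, ← mul_assoc]
  gcongr
  calc (3 : ℝ) ^ (1 - θ) ≤ 3 ^ (1 : ℝ) := by
        gcongr
        · norm_num
        · linarith
    _ = 3 := Real.rpow_one 3

/-- The space-time bound for the majorant of one block. -/
lemma eLpNorm_block_le (hM : 1 ≤ M) {α θ : ℝ} {q : ℝ≥0∞} (hα : 1 < α) (hα2 : α ≤ 2)
    (hθ1 : θ ≤ 1) (hq : q ≠ 0) (hqθ : θ = 6 / q.toReal) (b : Option (ℕ × Bool)) (c : Idx M → ℂ) :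
    eLpNorm (fun t => mass (block M b) c ^ (1 - θ) * ‖evolution (block M b) α c t‖ ^ θ) q
      timeMeasure ≤ ENNReal.ofReal (100 * (level b + 1) * ((2 : ℝ) ^ level b) ^ (θ / 3) *
        (α - 1) ^ (-(1 / 6) * θ) * mass (block M b) c) := by
  have ha : 0 < α - 1 := by linarith
  have hm := mass_nonneg (block M b) c
  set m := mass (block M b) c with hmd
  set N : ℝ := 2 ^ level b with hN
  set l : ℝ := (level b : ℝ) with hl
  have hl0 : 0 ≤ l := Nat.cast_nonneg _
  set X : ℝ := 10 ^ 12 * (l + 1) * 4 ^ level b / (α - 1) with hX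
  have hX0 : 0 < X := by positivity
  have hXle : X ^ (θ / 6) ≤ 100 * (l + 1) * N ^ (θ / 3) * (α - 1) ^ (-(1 / 6) * θ) := by
    have h4 : (4 : ℝ) ^ level b = N ^ (2 : ℝ) := by
      rw [Real.rpow_two, hN, ← pow_mul, mul_comm, pow_mul]; norm_num
    have h10 : ((10 : ℝ) ^ 12) = 100 ^ (6 : ℝ) := by norm_num
    have hN0 : 0 < N := by positivity
    calc X ^ (θ / 6) = (100 : ℝ) ^ θ * (l + 1) ^ (θ / 6) * N ^ (θ / 3) *
          (α - 1) ^ (-(1 / 6) * θ) := by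
          rw [hX, div_eq_mul_inv, Real.mul_rpow (by positivity) (by positivity),
            Real.mul_rpow (by positivity) (by positivity),
            Real.mul_rpow (by positivity) (by positivity), h4, h10, ← Real.rpow_mul (by positivity),
            ← Real.rpow_mul (by positivity), ← Real.rpow_neg_one, ← Real.rpow_mul ha.le]
          rw [show (6 : ℝ) * (θ / 6) = θ by ring, show (2 : ℝ) * (θ / 6) = θ / 3 by ring,
            show (-1 : ℝ) * (θ / 6) = -(1 / 6) * θ by ring]
      _ ≤ (100 : ℝ) ^ (1 : ℝ) * (l + 1) ^ (1 : ℝ) * N ^ (θ / 3) * (α - 1) ^ (-(1 / 6) * θ) := by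
          gcongr <;> linarith
      _ = _ := by rw [Real.rpow_one, Real.rpow_one]
  suffices h : eLpNorm (fun t => m ^ (1 - θ) * ‖evolution (block M b) α c t‖ ^ θ) q timeMeasure ≤
      ENNReal.ofReal (X ^ (θ / 6) * m) from
    h.trans (ENNReal.ofReal_le_ofReal (mul_le_mul_of_nonneg_right hXle hm))
  rcases eq_or_ne q ⊤ with rfl | hq'
  · have h0 : θ = 0 := by rw [hqθ]; simp
    simp only [h0, sub_zero, Real.rpow_one, Real.rpow_zero, mul_one, zero_div, one_mul,
      eLpNorm_exponent_top]
    exact eLpNormEssSup_le_of_ae_bound (ae_of_all _ fun _ => by rw [Real.norm_of_nonneg hm])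
  have hq0 : 0 < q.toReal := ENNReal.toReal_pos hq hq'
  -- Hence the `q`-th power of `‖·‖^θ` is the sixth power controlled by `lintegral_block`.
  have hθq : θ * q.toReal = 6 := by rw [hqθ]; field_simp
  have h6 : 6 / q.toReal = θ := hqθ.symm
  rw [eLpNorm_eq_lintegral_rpow_enorm_toReal hq hq']
  have e : ∀ t, ‖m ^ (1 - θ) * ‖evolution (block M b) α c t‖ ^ θ‖ₑ ^ q.toReal =
      ENNReal.ofReal (m ^ ((1 - θ) * q.toReal)) *
        ENNReal.ofReal (‖evolution (block M b) α c t‖ ^ 6) := fun t => by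
    have hv := norm_nonneg (evolution (block M b) α c t)
    rw [← ofReal_norm, Real.norm_of_nonneg (by positivity),
      ENNReal.ofReal_rpow_of_nonneg (by positivity) hq0.le, ← ENNReal.ofReal_mul (by positivity),
      Real.mul_rpow (by positivity) (by positivity), ← Real.rpow_mul hm, ← Real.rpow_mul hv, hθq]
    norm_num
  simp only [e]
  rw [lintegral_const_mul _ (by
    exact ((continuous_evolution _ _ _).norm.pow 6).measurable.ennreal_ofReal)]
  have hbl := lintegral_block hM hα hα2 b c
  calc _ ≤ (ENNReal.ofReal (m ^ ((1 - θ) * q.toReal)) *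
        ENNReal.ofReal (X * m ^ 6)) ^ (1 / q.toReal) := by gcongr
    _ = ENNReal.ofReal ((m ^ ((1 - θ) * q.toReal) * (X * m ^ 6)) ^ (1 / q.toReal)) := by
        rw [← ENNReal.ofReal_mul (by positivity),
          ENNReal.ofReal_rpow_of_nonneg (by positivity) (by positivity)]
    _ ≤ _ := by
        refine ENNReal.ofReal_le_ofReal (le_of_eq ?_)
        have e1 : m ^ ((1 - θ) * q.toReal) * (X * m ^ 6) = X * m ^ q.toReal := by
          have : m ^ q.toReal = m ^ ((1 - θ) * q.toReal) * m ^ (6 : ℝ) := by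
            rw [← Real.rpow_add' hm (by rw [← hθq]; ring_nf; exact hq0.ne')]
            congr 1
            rw [← hθq]
            ring
          rw [this]
          norm_num
          simp only [← Real.rpow_natCast]
          norm_num
          ring
        rw [e1, Real.mul_rpow hX0.le (by positivity), ← Real.rpow_mul hm,
          mul_one_div_cancel hq0.ne', Real.rpow_one]
        congr 2
        rw [← h6]
        field_simp

/-- The constant that results from the summation over the dyadic blocks. -/
noncomputable def blockConst (ε : ℝ) : ℝ :=
  -- `900 = 3 · 100 · 3`, from `majorant`, `eLpNorm_block_le` and `mass_le_coeffNorm`; `1` is the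
  -- origin and `2` counts the signs.
  900 * (1 + 2 * ∑' n : ℕ, ((n : ℝ) + 1) * ((2 : ℝ) ^ (-ε)) ^ n)

lemma summable_blockConst {ε : ℝ} (hε : 0 < ε) :
    Summable fun n : ℕ => ((n : ℝ) + 1) * ((2 : ℝ) ^ (-ε)) ^ n := by
  have h0 : (0 : ℝ) < (2 : ℝ) ^ (-ε) := by positivity
  have h1 : ‖(2 : ℝ) ^ (-ε)‖ < 1 := by
    rw [Real.norm_of_nonneg h0.le]
    exact Real.rpow_lt_one_of_one_lt_of_neg one_lt_two (by linarith)
  have := (summable_pow_mul_geometric_of_norm_lt_one 1 h1).add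
    (summable_pow_mul_geometric_of_norm_lt_one 0 h1)
  refine this.congr fun n => ?_
  simp
  ring

lemma sum_blocks_le {ε : ℝ} (hε : 0 < ε) :
    900 * ∑ b ∈ blocks M, ((level b : ℝ) + 1) * ((2 : ℝ) ^ (-ε)) ^ level b ≤ blockConst ε := by
  rw [blockConst, blocks, Finset.sum_insertNone, Finset.sum_product]
  have h := (summable_blockConst hε).sum_le_tsum (Finset.range (M + 1)) fun n _ => by positivity
  simp only [level, Fintype.sum_bool, ← two_mul, ← Finset.mul_sum] at h ⊢
  rw [Nat.cast_zero, zero_add, pow_zero, one_mul]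
  simp only [mul_left_comm _ (2 : ℝ), ← Finset.mul_sum]
  linarith

lemma coeffNorm_nonneg (s : ℝ) (c : Idx M → ℂ) : 0 ≤ coeffNorm s c := Real.sqrt_nonneg _

/-- The space-time bound for the majorant. -/
lemma eLpNorm_majorant_le (hM : 1 ≤ M) {α θ ε : ℝ} {q : ℝ≥0∞} (hα : 1 < α) (hα2 : α ≤ 2)
    (hε : 0 < ε) (hθ0 : 0 ≤ θ) (hθ1 : θ ≤ 1) (hq : 1 ≤ q) (hqθ : θ = 6 / q.toReal)
    (c : Idx M → ℂ) :
    eLpNorm (majorant α θ c) q timeMeasure ≤ ENNReal.ofReal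
      (blockConst ε * (α - 1) ^ (-(1 / 6) * θ) * coeffNorm (θ / 3 + ε) c) := by
  have ha : 0 < α - 1 := by linarith
  have hS := coeffNorm_nonneg (θ / 3 + ε) c
  have hmaj : majorant α θ c = ∑ b ∈ blocks M, (3 : ℝ) • fun t =>
      mass (block M b) c ^ (1 - θ) * ‖evolution (block M b) α c t‖ ^ θ := by
    ext t
    simp only [majorant, Finset.sum_apply, Pi.smul_apply, smul_eq_mul, Finset.mul_sum]
  rw [hmaj]
  refine (eLpNorm_sum_le (fun b _ => ?_) hq).trans ?_
  · exact (((continuous_evolution _ _ _).norm.rpow_const fun _ => Or.inr hθ0).const_mul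
      _).aestronglyMeasurable.const_smul _
  have hb : ∀ b ∈ blocks M, eLpNorm ((3 : ℝ) • fun t =>
      mass (block M b) c ^ (1 - θ) * ‖evolution (block M b) α c t‖ ^ θ) q timeMeasure ≤
      ENNReal.ofReal (900 * (((level b : ℝ) + 1) * ((2 : ℝ) ^ (-ε)) ^ level b) *
        ((α - 1) ^ (-(1 / 6) * θ) * coeffNorm (θ / 3 + ε) c)) := fun b _ => by
    refine (eLpNorm_const_smul_le (c := (3 : ℝ))).trans ?_
    refine (mul_le_mul_right (eLpNorm_block_le hM hα hα2 hθ1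
      (zero_lt_one.trans_le hq).ne' hqθ b c) _).trans ?_
    rw [← ofReal_norm, ← ENNReal.ofReal_mul (norm_nonneg _), Real.norm_of_nonneg (by norm_num)]
    refine ENNReal.ofReal_le_ofReal ?_
    have hN : (0 : ℝ) < 2 ^ level b := by positivity
    -- The extra `ε` derivatives give the geometric decay that sums the factors `level b + 1`.
    have hsplit : ((2 : ℝ) ^ level b) ^ (θ / 3) =
        ((2 : ℝ) ^ (-ε)) ^ level b * ((2 : ℝ) ^ level b) ^ (θ / 3 + ε) := by
      rw [← Real.rpow_mul_natCast (by norm_num), mul_comm (-ε), Real.rpow_natCast_mul (by norm_num),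
        ← Real.rpow_add (by positivity)]
      congr 1
      ring
    have := mass_le_coeffNorm (s := θ / 3 + ε) (by positivity) b c
    calc 3 * (100 * ((level b : ℝ) + 1) * ((2 : ℝ) ^ level b) ^ (θ / 3) *
          (α - 1) ^ (-(1 / 6) * θ) * mass (block M b) c)
        = 300 * (((level b : ℝ) + 1) * ((2 : ℝ) ^ (-ε)) ^ level b) * ((α - 1) ^ (-(1 / 6) * θ) *
          (((2 : ℝ) ^ level b) ^ (θ / 3 + ε) * mass (block M b) c)) := by rw [hsplit]; ring
      _ ≤ 300 * (((level b : ℝ) + 1) * ((2 : ℝ) ^ (-ε)) ^ level b) * ((α - 1) ^ (-(1 / 6) * θ) *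
          (3 * coeffNorm (θ / 3 + ε) c)) := by gcongr
      _ = _ := by ring
  refine (Finset.sum_le_sum hb).trans ?_
  rw [← ENNReal.ofReal_sum_of_nonneg fun b _ => by positivity]
  refine ENNReal.ofReal_le_ofReal ?_
  rw [← Finset.sum_mul, ← Finset.mul_sum, mul_assoc (blockConst ε)]
  exact mul_le_mul_of_nonneg_right (sum_blocks_le hε) (by positivity)

end

/-! ### Minkowski's integral inequality and the Duhamel term -/

/-- Minkowski's integral inequality, for a kernel whose sections are bounded in `L^q`. -/
lemma lintegral_rpow_lintegral_le {Ω Ω' : Type*} [MeasurableSpace Ω] [MeasurableSpace Ω']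
    {μ : Measure Ω} {ν : Measure Ω'} [SFinite μ] [IsProbabilityMeasure ν] {K : Ω → Ω' → ℝ≥0∞}
    (hK : Measurable (Function.uncurry K)) {q : ℝ} (hq : 1 < q) {B : Ω' → ℝ≥0∞}
    (hB : Measurable B) (hBt : ∀ s, B s ≠ ∞) (hKB : ∀ s, ∫⁻ t, K t s ^ q ∂μ ≤ B s ^ q) :
    ∫⁻ t, (∫⁻ s, K t s ∂ν) ^ q ∂μ ≤ (∫⁻ s, B s ∂ν) ^ q := by
  have hq0 : 0 < q := by linarith
  -- Hölder for `K = W^(1/p) · K W^(-1/p)`, where `W = B + δ` never vanishes; `δ` tends to `0` at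
  -- the end.
  have hδ : ∀ δ : ℝ≥0∞, δ ≠ 0 → δ ≠ ∞ →
      ∫⁻ t, (∫⁻ s, K t s ∂ν) ^ q ∂μ ≤ (∫⁻ s, B s ∂ν + δ) ^ q := fun δ hδ0 hδt => by
    set W : Ω' → ℝ≥0∞ := fun s => B s + δ with hW
    have hWm : Measurable W := hB.add_const δ
    have hW0 : ∀ s, W s ≠ 0 := fun s => by simp [hW, hδ0]
    have hWt : ∀ s, W s ≠ ∞ := fun s => ENNReal.add_ne_top.2 ⟨hBt s, hδt⟩
    have hWi : ∫⁻ s, W s ∂ν = ∫⁻ s, B s ∂ν + δ := by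
      rw [lintegral_add_right _ measurable_const]; simp
    set p := q.conjExponent with hp
    have hpq : p.HolderConjugate q := (Real.HolderConjugate.conjExponent hq).symm
    have hp0 : 0 < p := hpq.pos
    have hqp : q / p = q - 1 := by
      have := hpq.symm.sub_one_mul_conj
      field_simp
      linarith
    have hKs : ∀ t, Measurable (K t) := fun t => hK.comp measurable_prodMk_left
    have h1 : ∀ t, (∫⁻ s, K t s ∂ν) ^ q ≤
        (∫⁻ s, W s ∂ν) ^ (q - 1) * ∫⁻ s, K t s ^ q * W s ^ (1 - q) ∂ν := fun t => by
      have hold := ENNReal.lintegral_mul_le_Lp_mul_Lq ν hpq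
        (f := fun s => W s ^ (1 / p)) (g := fun s => K t s * W s ^ (-(1 / p)))
        (hWm.pow_const _).aemeasurable ((hKs t).mul (hWm.pow_const _)).aemeasurable
      have e1 : ∀ s, (fun s => W s ^ (1 / p)) s * (fun s => K t s * W s ^ (-(1 / p))) s = K t s :=
        fun s => by
          dsimp only
          rw [mul_left_comm, ← ENNReal.rpow_add _ _ (hW0 s) (hWt s), add_neg_cancel,
            ENNReal.rpow_zero, mul_one]
      have e2 : ∀ s, (W s ^ (1 / p)) ^ p = W s := fun s => by
        rw [← ENNReal.rpow_mul, one_div_mul_cancel hp0.ne', ENNReal.rpow_one]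
      have e3 : ∀ s, (K t s * W s ^ (-(1 / p))) ^ q = K t s ^ q * W s ^ (1 - q) := fun s => by
        rw [ENNReal.mul_rpow_of_nonneg _ _ hq0.le, ← ENNReal.rpow_mul]
        congr 2
        linarith [show -(1 / p) * q = -(q / p) by ring]
      simp only [Pi.mul_apply, e1, e2, e3] at hold
      calc (∫⁻ s, K t s ∂ν) ^ q ≤ _ := ENNReal.rpow_le_rpow hold hq0.le
        _ = _ := by
          rw [ENNReal.mul_rpow_of_nonneg _ _ hq0.le, ← ENNReal.rpow_mul, ← ENNReal.rpow_mul,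
            one_div_mul_cancel hq0.ne', ENNReal.rpow_one, one_div_mul_eq_div, hqp]
    calc ∫⁻ t, (∫⁻ s, K t s ∂ν) ^ q ∂μ
        ≤ ∫⁻ t, (∫⁻ s, W s ∂ν) ^ (q - 1) * ∫⁻ s, K t s ^ q * W s ^ (1 - q) ∂ν ∂μ :=
          lintegral_mono h1
      _ = (∫⁻ s, W s ∂ν) ^ (q - 1) * ∫⁻ t, ∫⁻ s, K t s ^ q * W s ^ (1 - q) ∂ν ∂μ := by
          refine lintegral_const_mul _ (Measurable.lintegral_prod_right ?_)
          exact (hK.pow_const q).mul ((hWm.comp measurable_snd).pow_const _)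
      _ = (∫⁻ s, W s ∂ν) ^ (q - 1) * ∫⁻ s, (∫⁻ t, K t s ^ q ∂μ) * W s ^ (1 - q) ∂ν := by
          rw [lintegral_lintegral_swap ((hK.pow_const q).mul
            ((hWm.comp measurable_snd).pow_const _)).aemeasurable]
          congr 1
          refine lintegral_congr fun s => ?_
          rw [lintegral_mul_const]
          exact (hK.comp measurable_prodMk_right).pow_const q
      _ ≤ (∫⁻ s, W s ∂ν) ^ (q - 1) * ∫⁻ s, W s ∂ν := by
          gcongr with s
          calc (∫⁻ t, K t s ^ q ∂μ) * W s ^ (1 - q) ≤ W s ^ q * W s ^ (1 - q) := by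
                gcongr
                refine (hKB s).trans ?_
                gcongr
                exact le_self_add
            _ = W s := by
                rw [← ENNReal.rpow_add _ _ (hW0 s) (hWt s), add_sub_cancel, ENNReal.rpow_one]
      _ = (∫⁻ s, W s ∂ν) ^ q := by
          conv_lhs => rw [← ENNReal.rpow_one (∫⁻ s, W s ∂ν)]
          rw [ENNReal.rpow_one, ← ENNReal.rpow_one (∫⁻ s, W s ∂ν), ← ENNReal.rpow_mul,
            ← ENNReal.rpow_add_of_nonneg _ _ (by linarith) zero_le_one]
          norm_num
      _ = _ := by rw [hWi]
  rw [← ENNReal.rpow_inv_le_iff hq0]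
  refine ENNReal.le_of_forall_pos_le_add fun δ hδ0 _ => ?_
  rw [ENNReal.rpow_inv_le_iff hq0]
  exact hδ δ (by exact_mod_cast hδ0.ne') ENNReal.coe_ne_top

/-- The triangle inequality for integrals, in the `L^r` norm of a finite measure space. -/
lemma eLpNorm_integral_le {ι Ω : Type*} [Fintype ι] [MeasurableSpace ι] [DiscreteMeasurableSpace ι]
    [MeasurableSpace Ω] {μ : Measure ι} [IsFiniteMeasure μ] {ν : Measure Ω} {r : ℝ≥0∞} (hr : 1 ≤ r)
    (f : Ω → ι → ℂ) :
    eLpNorm (∫ a, f a ∂ν) r μ ≤ ∫⁻ a, eLpNorm (f a) r μ ∂ν := by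
  have : Fact (1 ≤ r) := ⟨hr⟩
  have hmem : ∀ g : ι → ℂ, MemLp g r μ := fun g =>
    MemLp.of_bound .of_discrete ‖g‖ (ae_of_all _ fun i => norm_le_pi_norm g i)
  let Λ₀ : (ι → ℂ) →ₗ[ℝ] Lp ℂ r μ :=
    { toFun := fun g => (hmem g).toLp g
      map_add' := fun _ _ => rfl
      map_smul' := fun _ _ => rfl }
  -- The passage to `Lp` is linear on a finite-dimensional space, hence continuous, and so commutes
  -- with the integral.
  let Λ : (ι → ℂ) →L[ℝ] Lp ℂ r μ := LinearMap.toContinuousLinearMap Λ₀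
  have hΛ : ∀ g, ‖Λ g‖ₑ = eLpNorm g r μ := fun g => Lp.enorm_toLp (hf := hmem g)
  by_cases hf : Integrable f ν
  · rw [← hΛ, ← ContinuousLinearMap.integral_comp_comm Λ hf]
    refine (enorm_integral_le_lintegral_enorm _).trans (le_of_eq ?_)
    exact lintegral_congr fun a => hΛ _
  -- A nonintegrable `f` has Bochner integral `0`.
  · rw [integral_undef hf]
    simp

section

variable {M : ℕ}

instance : IsFiniteMeasure (latticeMeasure M) := by
  unfold latticeMeasure
  exact Measure.smul_finite _ ENNReal.ofReal_ne_top

/-- The coefficients of the source term, transported to time zero. -/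
noncomputable def transported (α : ℝ) (F : ℝ → Idx M → ℂ) (s : ℝ) (k : Idx M) : ℂ :=
  Complex.exp (Complex.I * ((s * symbol M α k.1 : ℝ) : ℂ)) * dft (F s) k

/-- The group law: `s` enters only through the coefficients, so the homogeneous bound applies for
each fixed `s`. -/
lemma propagator_sub (α t s : ℝ) (F : ℝ → Idx M → ℂ) :
    propagator α (t - s) (F s) = flow α (transported α F s) t := by
  unfold propagator flow transported
  congr 1
  ext k
  rw [← mul_assoc, ← Complex.exp_add]
  congr 2
  push_cast
  ring

lemma coeffNorm_transported (α σ : ℝ) (F : ℝ → Idx M → ℂ) (s : ℝ) :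
    coeffNorm σ (transported α F s) = sobolevNorm σ (F s) := by
  have : ∀ k : Idx M, ‖transported α F s k‖ = ‖dft (F s) k‖ := fun k => by
    rw [transported, norm_mul, mul_comm Complex.I, Complex.norm_exp_ofReal_mul_I, one_mul]
  simp only [coeffNorm, sobolevNorm, this]

lemma measurable_majorant (α θ : ℝ) {F : ℝ → Idx M → ℂ} (hF : Measurable F) :
    Measurable fun p : ℝ × ℝ => majorant α θ (transported α F p.2) p.1 := by
  have hFk : ∀ k, Measurable fun s => F s k := fun k => (measurable_pi_apply k).comp hF
  have hd : ∀ k, Measurable fun p : ℝ × ℝ => transported α F p.2 k := fun k => by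
    unfold transported dft
    fun_prop
  unfold majorant mass
  refine Measurable.const_mul (Finset.measurable_sum _ fun b _ => Measurable.mul ?_ ?_) _
  · exact (Measurable.sqrt (Finset.measurable_sum _ fun k _ => (hd k).norm.pow_const 2)).pow_const _
  · refine Measurable.pow_const (Measurable.norm ?_) _
    refine measurable_pi_iff.2 fun j => ?_
    unfold evolution
    refine Finset.measurable_sum _ fun k _ => (hd k).mul ?_
    fun_prop

lemma measurable_sobolevNorm (σ : ℝ) {F : ℝ → Idx M → ℂ} (hF : Measurable F) :
    Measurable fun s => sobolevNorm σ (F s) := by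
  have hFk : ∀ k, Measurable fun s => F s k := fun k => (measurable_pi_apply k).comp hF
  unfold sobolevNorm dft
  fun_prop

/-- Once norms are inside, the integrand is nonnegative and `(0, t]` may be enlarged to `[0, 1]`;
the retarded cutoff disappears. -/
lemma latticeNorm_duhamel_le (hM : 1 ≤ M) {r : ℝ≥0∞} (hr : 2 ≤ r) {θ : ℝ}
    (hθ : θ = 1 - 2 / r.toReal) (hθ0 : 0 ≤ θ) (α : ℝ) (F : ℝ → Idx M → ℂ) {t : ℝ}
    (ht : t ∈ Set.Icc (0 : ℝ) 1) :
    latticeNorm r (duhamel α F t) ≤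
      ∫⁻ s, ENNReal.ofReal (majorant α θ (transported α F s) t) ∂timeMeasure := by
  unfold duhamel latticeNorm
  rw [intervalIntegral.integral_of_le ht.1]
  refine (eLpNorm_integral_le (le_trans (by norm_num) hr) _).trans ?_
  refine (lintegral_mono fun s => ?_).trans (lintegral_mono' (Measure.restrict_mono
    (Set.Ioc_subset_Icc_self.trans (Set.Icc_subset_Icc_right ht.2)) le_rfl) le_rfl)
  rw [propagator_sub]
  exact latticeNorm_flow_le hM hr hθ hθ0 α _ t

lemma majorant_zero_exponent (α : ℝ) (c : Idx M → ℂ) (t s : ℝ) :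
    majorant α 0 c t = majorant α 0 c s := by
  simp [majorant]

/-- The inhomogeneous estimate. -/
lemma spacetimeNorm_duhamel_le (hM : 1 ≤ M) {α θ σ D : ℝ} {q r : ℝ≥0∞} (hr : 2 ≤ r) (hq : 2 ≤ q)
    (hθ : θ = 1 - 2 / r.toReal) (hθ0 : 0 ≤ θ) (hqθ : θ = 6 / q.toReal) (hD : 0 ≤ D)
    (hmaj : ∀ c : Idx M → ℂ, eLpNorm (majorant α θ c) q timeMeasure ≤
      ENNReal.ofReal (D * coeffNorm σ c))
    {F : ℝ → Idx M → ℂ} (hF : Integrable F timeMeasure) :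
    spacetimeNorm q r (duhamel α F) ≤ ENNReal.ofReal D * sourceNorm σ F := by
  -- A measurable representative provides the joint measurability that Minkowski's inequality needs.
  obtain ⟨G, hG, hFG⟩ := hF.1
  have hGm : Measurable G := hG.measurable
  have hsrc : sourceNorm σ F = ∫⁻ s, ENNReal.ofReal (sobolevNorm σ (G s)) ∂timeMeasure := by
    rw [sourceNorm, eLpNorm_one_eq_lintegral_enorm]
    refine lintegral_congr_ae ?_
    filter_upwards [hFG] with s hs
    rw [hs, ← ofReal_norm, Real.norm_of_nonneg (show 0 ≤ sobolevNorm σ (G s) from Real.sqrt_nonneg _)]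
  set K : ℝ → ℝ → ℝ≥0∞ := fun t s => ENNReal.ofReal (majorant α θ (transported α G s) t) with hK
  set B : ℝ → ℝ≥0∞ := fun s => ENNReal.ofReal (D * sobolevNorm σ (G s)) with hB
  have hBm : Measurable B := ((measurable_sobolevNorm σ hGm).const_mul D).ennreal_ofReal
  have hBi : ∫⁻ s, B s ∂timeMeasure = ENNReal.ofReal D * sourceNorm σ F := by
    rw [hsrc, ← lintegral_const_mul _ (measurable_sobolevNorm σ hGm).ennreal_ofReal]
    exact lintegral_congr fun s => ENNReal.ofReal_mul hD
  have hKm : Measurable (Function.uncurry K) := (measurable_majorant α θ hGm).ennreal_ofReal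
  have hpt : ∀ t ∈ Set.Icc (0 : ℝ) 1,
      latticeNorm r (duhamel α F t) ≤ ∫⁻ s, K t s ∂timeMeasure := fun t ht => by
    refine (latticeNorm_duhamel_le hM hr hθ hθ0 α F ht).trans (le_of_eq (lintegral_congr_ae ?_))
    filter_upwards [hFG] with s hs
    have : transported α F s = transported α G s := by ext k; simp only [transported, hs]
    rw [this]
  have hae : ∀ᵐ t ∂timeMeasure, ‖latticeNorm r (duhamel α F t)‖ₑ ≤ ‖∫⁻ s, K t s ∂timeMeasure‖ₑ := by
    refine (ae_restrict_iff' measurableSet_Icc).2 (ae_of_all _ fun t ht => ?_)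
    rw [enorm_eq_self, enorm_eq_self]
    exact hpt t ht
  rw [← hBi]
  refine (eLpNorm_mono_enorm_ae hae).trans ?_
  have hsec : ∀ s, eLpNorm (majorant α θ (transported α G s)) q timeMeasure ≤ B s := fun s => by
    have := hmaj (transported α G s)
    rwa [coeffNorm_transported] at this
  rcases eq_or_ne q ⊤ with rfl | hq'
  -- For `q = ∞` the majorant is constant in time, so its essential supremum bounds it at every `t`.
  · have h0 : θ = 0 := by rw [hqθ]; simp
    rw [eLpNorm_exponent_top]
    refine eLpNormEssSup_le_of_ae_enorm_bound (ae_of_all _ fun t => ?_)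
    rw [enorm_eq_self]
    refine lintegral_mono fun s => le_trans (le_of_eq ?_) (hsec s)
    have e : majorant α θ (transported α G s) = fun _ => majorant α θ (transported α G s) t := by
      ext t'
      rw [h0]
      exact majorant_zero_exponent _ _ _ _
    rw [e, eLpNorm_const _ (by simp) (IsProbabilityMeasure.ne_zero _)]
    rw [← ofReal_norm, Real.norm_of_nonneg (majorant_nonneg _ _ _ _)]
    simp [hK]
  have hq2 : 2 ≤ q.toReal := by
    simpa using (ENNReal.toReal_le_toReal (by simp) hq').2 hq
  have hq0 : 0 < q.toReal := by linarith
  have hqne : q ≠ 0 := (lt_of_lt_of_le (by norm_num) hq).ne'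
  rw [eLpNorm_eq_lintegral_rpow_enorm_toReal hqne hq', one_div, ENNReal.rpow_inv_le_iff hq0]
  simp only [enorm_eq_self]
  refine lintegral_rpow_lintegral_le hKm (by linarith) hBm (fun s => ENNReal.ofReal_ne_top)
    fun s => ?_
  have := hsec s
  rw [eLpNorm_eq_lintegral_rpow_enorm_toReal hqne hq', one_div, ENNReal.rpow_inv_le_iff hq0] at this
  refine le_trans (le_of_eq (lintegral_congr fun t => ?_)) this
  rw [← ofReal_norm, Real.norm_of_nonneg (majorant_nonneg _ _ _ _)]

/-- All exponents are expressed through `θ = 1 - 2/r`; `toReal` sends `2/∞` to `0`, in accordance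
with `1/∞ = 0`. -/
lemma LatticeAdmissible.exponents {q r : ℝ≥0∞} (h : LatticeAdmissible q r) :
    1 - (2 / r).toReal = 6 / q.toReal ∧ 1 - (2 / r).toReal = 1 - 2 / r.toReal ∧
      (2 / q).toReal = (1 - (2 / r).toReal) / 3 ∧ 0 ≤ 1 - (2 / r).toReal ∧
      1 - (2 / r).toReal ≤ 1 := by
  obtain ⟨hq, hr, h⟩ := h
  have hq0 : q ≠ 0 := (lt_of_lt_of_le (by norm_num) hq).ne'
  have hr0 : r ≠ 0 := (lt_of_lt_of_le (by norm_num) hr).ne'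
  have h' := congrArg ENNReal.toReal h
  rw [ENNReal.toReal_add (ENNReal.div_ne_top (by simp) hq0) (ENNReal.div_ne_top (by simp) hr0)] at h'
  simp only [ENNReal.toReal_div, ENNReal.toReal_ofNat, ENNReal.toReal_one] at h' ⊢
  have e1 : 6 / q.toReal = 2 * (3 / q.toReal) := by ring
  have e2 : 2 / q.toReal = 2 / 3 * (3 / q.toReal) := by ring
  have e3 : 2 / r.toReal = 2 * (1 / r.toReal) := by ring
  have h3 : 0 ≤ 3 / q.toReal := by positivity
  have h4 : 0 ≤ 1 / r.toReal := by positivity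
  rw [e1, e2, e3]
  refine ⟨?_, trivial, ?_, ?_, ?_⟩ <;> linarith

end

end FDNLS

open FDNLS in
theorem mainTheorem6 :
    ∀ ε : ℝ, 0 < ε → ∃ C : ℝ, 0 < C ∧
      ∀ α : ℝ, 1 < α → α ≤ 2 →
      ∀ q r : ℝ≥0∞, FDNLS.LatticeAdmissible q r →
      ∀ M : ℕ, 1 ≤ M →
        (∀ f : FDNLS.Idx M → ℂ,
          FDNLS.spacetimeNorm q r (fun t => FDNLS.propagator α t f) ≤
            ENNReal.ofReal (C * |α - 1| ^ (-(1 / 6 : ℝ) * (1 - (2 / r).toReal))) *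
              ENNReal.ofReal (FDNLS.sobolevNorm ((2 / q).toReal + ε) f)) ∧
        (∀ F : ℝ → FDNLS.Idx M → ℂ, Integrable F FDNLS.timeMeasure →
          FDNLS.spacetimeNorm q r (FDNLS.duhamel α F) ≤
            ENNReal.ofReal (C * |α - 1| ^ (-(1 / 3 : ℝ) * (1 - (2 / r).toReal))) *
              FDNLS.sourceNorm ((2 / q).toReal + ε) F) := by
  intro ε hε
  have hC : 0 < blockConst ε := by
    have : 0 ≤ ∑' n : ℕ, ((n : ℝ) + 1) * ((2 : ℝ) ^ (-ε)) ^ n := tsum_nonneg fun n => by positivity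
    unfold blockConst
    positivity
  refine ⟨blockConst ε, hC, fun α hα hα2 q r hqr M hM => ?_⟩
  have ha : 0 < α - 1 := by linarith
  obtain ⟨h1, h2, h3, h4, h5⟩ := hqr.exponents
  obtain ⟨hq, hr, -⟩ := hqr
  rw [h3, abs_of_pos ha]
  set θ := 1 - (2 / r).toReal with hθ
  have hq1 : 1 ≤ q := le_trans (by norm_num) hq
  have hmaj := fun c : Idx M → ℂ => eLpNorm_majorant_le hM hα hα2 hε h4 h5 hq1 h1 c
  refine ⟨fun f => ?_, fun F hF => ?_⟩
  · rw [← ENNReal.ofReal_mul (by positivity)]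
    refine (eLpNorm_mono_enorm fun t => ?_).trans (hmaj (dft f))
    rw [enorm_eq_self, ← ofReal_norm, Real.norm_of_nonneg (majorant_nonneg _ _ _ _)]
    exact latticeNorm_flow_le hM hr h2 h4 α (dft f) t
  · refine (spacetimeNorm_duhamel_le hM hr hq h2 h4 h1 (by positivity) hmaj hF).trans ?_
    gcongr ENNReal.ofReal (_ * ?_) * _
    -- Minkowski preserves the power `-θ/6`; since `α - 1 ≤ 1`, the stated power `-θ/3` is weaker.
    exact Real.rpow_le_rpow_of_exponent_ge ha (by linarith) (by linarith)
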